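/- Multigraphs are finite and may have parallel edges and self-loops; a self-loop at $v$ contributes two to the degree of $v$. A path in a multigraph has at least one edge and uses each edge at most once, but may repeat vertices; its length is its number of edges. For a positive integer $\lambda$ and $\delta\in\mathbb{R}_{\ge 0}$, a $(\delta,\lambda)$-path decomposition of a multigraph $G=(V,E)$ is a partition $\mathcal{P}$ of $E$ into edge-disjoint paths of length at most $\lambda$ such that for every $v\in V$ at most $\delta$ paths of $\mathcal{P}$ start or end in $v$, where a closed path from $v$ to $v$ counts twice. In the $\mathsf{LOCAL}$ model, the nodes of an $n$-node multigraph carry distinct natural numbers as identifiers, and each node $v$ has its incident edge-endpoints numbered arbitrarily $0,\dots,d(v)-1$ (its ports). Initially a node knows $n$, its identifier and its degree. In each synchronous round every node sends one message of arbitrary size through each of its ports, receives the messages sent to it and performs an arbitrary local computation. An algorithm computes a path decomposition $\mathcal{P}$ if at the end every node outputs exactly the paths of $\mathcal{P}$ to which it belongs, written in terms of node identifiers and port numbers. Theorem. There is an absolute constant $C$ such that for all integers $\Delta$ and $k$ with $1\le k\le \Delta/2-2$ there is a deterministic $\mathsf{LOCAL}$ algorithm that, for every $n\ge 2$ and on every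 $\Delta$-regular multigraph with $n$ nodes, for all choices of identifiers and port numberings, computes a $(\Delta-2k,\,2^k)$-path decomposition within at most $C\cdot 2^k\log n$ rounds. -/

import Mathlib

open scoped Graph NNReal

namespace LocalModel

/-! ### Finite multigraphs (with parallel edges and self-loops), paths, path decompositions -/

section Multigraph

variable {α β : Type*}

/-- The degree of a vertex of a finite multigraph: a self-loop at `v` contributes two. -/
noncomputable def degree (G : Graph α β) (v : α) : ℕ :=
  (G.incidenceSet v).ncard + (G.loopSet v).ncard

/-- The data of a (candidate) path: the start vertex, and the list of traversed edges, each one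
with the vertex that is reached by traversing it. -/
structure EdgePath (α β : Type*) where
  start : α
  steps : List (β × α)

namespace EdgePath

/-- The edges of a path, in the order of traversal. -/
def edges (p : EdgePath α β) : List β := p.steps.map Prod.fst

/-- The vertices of a path, in the order of traversal. -/
def vertices (p : EdgePath α β) : List α := p.start :: p.steps.map Prod.snd

/-- The last vertex of a path. -/
def finish (p : EdgePath α β) : α := p.vertices.getLast (List.cons_ne_nil _ _)

/-- The number of edges of a path. -/
def length (p : EdgePath α β) : ℕ := p.steps.length

/-- Renaming the vertices and the edges of a path. -/
def map {α' β' : Type*} (f : α → α') (g : β → β') (p : EdgePath α β) : EdgePath α' β' where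
  start := f p.start
  steps := p.steps.map (Prod.map g f)

end EdgePath

/-- Starting in `u`, the list `l` of pairs (edge, next vertex) follows edges of `G`. -/
def IsWalkFrom (G : Graph α β) : α → List (β × α) → Prop
  | u, [] => u ∈ V(G)
  | u, (e, w) :: l => G.IsLink e u w ∧ IsWalkFrom G w l

/-- A path in a multigraph has at least one edge and uses each edge at most once; its vertices
need not be distinct. -/
structure IsPathIn (G : Graph α β) (p : EdgePath α β) : Prop where
  walk : IsWalkFrom G p.start p.steps
  nodup : p.edges.Nodup
  ne_nil : p.steps ≠ []

/-- `P` is a `(δ, l)`-path decomposition of `G`: the members of `P` are paths of `G`, each edge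
of `G` lies on exactly one of them, at most `δ v` of them start or end in `v` (a closed path from
`v` to `v` counts twice, as it is a self-loop of the multigraph whose edges are the paths), and
each of them has length at most `l`. -/
structure IsPathDecomposition (G : Graph α β) (δ : α → ℝ≥0) (l : ℕ)
    (P : Finset (EdgePath α β)) : Prop where
  isPath : ∀ p ∈ P, IsPathIn G p
  partition : ∀ e ∈ E(G), ∃! p, p ∈ P ∧ e ∈ p.edges
  ends_le : ∀ v ∈ V(G),
    (({p | p ∈ P ∧ p.start = v}.ncard + {p | p ∈ P ∧ p.finish = v}.ncard : ℕ) : ℝ≥0) ≤ δ v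
  length_le : ∀ p ∈ P, p.length ≤ l

/-! ### Port numberings -/

/-- The ports (edge-endpoints) of a multigraph: each vertex `v` has ports `0, …, degree v - 1`. -/
abbrev Port (G : Graph α β) : Type _ := Σ v : α, Fin (degree G v)

/-- A port numbering attaches to each port of `v` an edge at `v`, in such a way that each edge is
attached to exactly two ports, one at each of its two ends (so a self-loop at `v` occupies two
ports of `v`). `opp p` is the other port of the edge at `p`. -/
structure PortNumbering (G : Graph α β) where
  edge : Port G → β
  opp : Port G → Port G
  isLink : ∀ p, G.IsLink (edge p) p.1 (opp p).1
  opp_ne : ∀ p, opp p ≠ p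
  edge_eq_iff : ∀ p q, edge p = edge q ↔ q = p ∨ q = opp p
  edge_surj : ∀ e ∈ E(G), ∃ p, edge p = e

namespace PortNumbering

variable {G : Graph α β}

/-- A port is named by the identifier of its vertex and its number at this vertex. -/
def portName (_π : PortNumbering G) (ident : α → ℕ) (p : Port G) : ℕ × ℕ := (ident p.1, p.2)

/-- An edge is named by the unordered pair of the names of its two ports. -/
noncomputable def edgeName (π : PortNumbering G) (ident : α → ℕ) : β → Sym2 (ℕ × ℕ) :=
  Function.extend π.edge (fun p => s(π.portName ident p, π.portName ident (π.opp p)))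
    (fun _ => s((0, 0), (0, 0)))

theorem opp_opp (π : PortNumbering G) (p : Port G) : π.opp (π.opp p) = p := by
  have h : π.edge p = π.edge (π.opp p) := (π.edge_eq_iff _ _).2 (Or.inr rfl)
  rcases (π.edge_eq_iff _ _).1 h.symm with h | h
  · exact absurd h.symm (π.opp_ne p)
  · exact h.symm

theorem edgeName_edge (π : PortNumbering G) (ident : α → ℕ) (p : Port G) :
    π.edgeName ident (π.edge p) = s(π.portName ident p, π.portName ident (π.opp p)) := by
  refine Function.FactorsThrough.extend_apply (f := π.edge) ?_ _ p
  intro a b hab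
  rcases (π.edge_eq_iff _ _).1 hab with rfl | rfl
  · rfl
  · simp only [opp_opp]
    exact Sym2.eq_swap

end PortNumbering

end Multigraph

/-! ### Deterministic algorithms in the LOCAL model -/

/-- A deterministic algorithm in the LOCAL model. A node starts in a state that depends only on
the number `n` of nodes, its own identifier and its own degree. In each round it sends one message
through each of its ports and then updates its state from its old state and the messages that have
arrived through its ports. After `rounds n` rounds it produces its output from its state. Message
sizes and local computations are unrestricted. -/
structure LocalAlgorithm (Out : Type) where
  State : Type
  Msg : Type
  init : (n ident deg : ℕ) → State
  send : State → (port : ℕ) → Msg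
  receive : State → {deg : ℕ} → (Fin deg → Msg) → State
  output : State → Out
  rounds : ℕ → ℕ

namespace LocalAlgorithm

variable {α β : Type*} {Out : Type}

/-- The state of node `v` after `t` synchronous rounds on the network `G` with the given port
numbering and identifiers: the message received at a port is the one that was sent through the
opposite port. -/
noncomputable def stateAt (A : LocalAlgorithm Out) {G : Graph α β} (π : PortNumbering G)
    (ident : α → ℕ) : ℕ → α → A.State
  | 0, v => A.init V(G).ncard (ident v) (degree G v)
  | t + 1, v => A.receive (A.stateAt π ident t v) (fun i : Fin (degree G v) =>
      A.send (A.stateAt π ident t (π.opp ⟨v, i⟩).1) (π.opp ⟨v, i⟩).2)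

/-- The output of node `v` at the end of the execution. -/
noncomputable def outputAt (A : LocalAlgorithm Out) {G : Graph α β} (π : PortNumbering G)
    (ident : α → ℕ) (v : α) : Out :=
  A.output (A.stateAt π ident (A.rounds V(G).ncard) v)

end LocalAlgorithm

/-- What a node outputs when it has to know a set of paths: each path is written down with the
identifiers of its vertices and the names of its edges. -/
abbrev PathSet : Type := Set (EdgePath ℕ (Sym2 (ℕ × ℕ)))

/-- In the execution of `A` on the given network, a `(δ, l)`-path decomposition `P` is computed:
every node outputs exactly the set of those paths of `P` that it belongs to. -/
def ComputesPathDecomposition {α β : Type*} (A : LocalAlgorithm PathSet) {G : Graph α β}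
    (π : PortNumbering G) (ident : α → ℕ) (δ : α → ℝ≥0) (l : ℕ) : Prop :=
  ∃ P : Finset (EdgePath α β), IsPathDecomposition G δ l P ∧
    ∀ v ∈ V(G), A.outputAt π ident v =
      {q | ∃ p ∈ P, v ∈ p.vertices ∧ q = p.map ident (π.edgeName ident)}

end LocalModel

/-!
Suppose that the edges have been partitioned into paths of length at most `2 ^ i`, and that at least
six path ends lie at every node. Split every node into two cells with at least three path ends each,
and regard the paths as the edges of a graph on the cells. Its minimum degree is at least three, and
around each cell there is a ball of radius `O(log n)` that grows by a factor of at most `3 / 2` in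
the next step. The larger ball then has at least as many edges as cells, so it has an edge outside
of some spanning tree. Orienting the tree towards one end of this edge, and the edge away from it,
gives every cell of the ball an outgoing path: a trap, which can be left nowhere. Each cell chooses
an outgoing path in the first trap that passes through it, in a fixed enumeration of all traps of
small diameter. Opposite choices would lie in the same trap, so no path is chosen from both of its
ends. Therefore joining, at every node, the two paths chosen by its two cells never joins more than
two paths in a row: the length bound doubles, and every node loses two path ends.

A round of joining takes `O(2 ^ i * log n)` communication rounds, and these costs sum to a geometric
series. Since every choice depends only on a neighborhood of bounded radius, a node can collect its
view up to this radius and evaluate the decomposition on any network that is consistent with it.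
-/

namespace LocalModel

/-! ### Traps in graphs of minimum degree three -/

section DartGraph

variable {D W : Type*} {opp : D → D} {src : D → W}

/-- The graph spanned by a set `E` of darts (oriented edges): the dart `d` runs from `src d` to
`src (opp d)`, where `opp d` is the reversed dart. -/
def dartGraph (opp : D → D) (src : D → W) (E : Set D) : SimpleGraph W :=
  SimpleGraph.fromRel fun a b => ∃ d ∈ E, src d = a ∧ src (opp d) = b

theorem edist_dartGraph_le_one {E : Set D} {d : D} (hd : d ∈ E) :
    (dartGraph opp src E).edist (src d) (src (opp d)) ≤ 1 := by
  rw [SimpleGraph.edist_le_one_iff_adj_or_eq]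
  by_cases h : src d = src (opp d)
  · exact .inr h
  · exact .inl ⟨h, .inl ⟨d, hd, rfl, rfl⟩⟩

theorem reachable_dartGraph {E : Set D} {d : D} (hd : d ∈ E) :
    (dartGraph opp src E).Reachable (src d) (src (opp d)) :=
  SimpleGraph.reachable_of_edist_ne_top
    ((edist_dartGraph_le_one hd).trans_lt ENat.one_lt_top).ne

theorem exists_dist_lt_of_reachable (hopp : Function.Involutive opp) {E : Set D}
    (hE : ∀ d ∈ E, opp d ∈ E) {z x : W} (h : (dartGraph opp src E).Reachable z x) (hne : z ≠ x) :
    ∃ d ∈ E, src d = z ∧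
      (dartGraph opp src E).dist (src (opp d)) x < (dartGraph opp src E).dist z x := by
  obtain ⟨p, hp⟩ := h.exists_walk_length_eq_dist
  cases p with
  | nil => exact absurd rfl hne
  | @cons _ y _ hzy p =>
    obtain ⟨d, hd, hdz, hdy⟩ : ∃ d ∈ E, src d = z ∧ src (opp d) = y := by
      rcases hzy.2 with ⟨d, hd, hz, hy⟩ | ⟨d, hd, hy, hz⟩
      · exact ⟨d, hd, hz, hy⟩
      · exact ⟨opp d, hE d hd, hz, by rw [hopp, hy]⟩
    refine ⟨d, hd, hdz, ?_⟩
    rw [hdy, ← hp, SimpleGraph.Walk.length_cons]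
    exact Nat.lt_succ_of_le (SimpleGraph.dist_le p)

theorem exists_parent_of_forall_reachable [Nonempty D] (hopp : Function.Involutive opp) {E : Set D}
    (hE : ∀ d ∈ E, opp d ∈ E) {B : Set W} {w : W}
    (hconn : ∀ z ∈ B, (dartGraph opp src E).Reachable z w) :
    ∃ parent : W → D, ∀ z ∈ B, z ≠ w → parent z ∈ E ∧ src (parent z) = z ∧
      (dartGraph opp src E).dist (src (opp (parent z))) w < (dartGraph opp src E).dist z w := by
  have hstep (z : W) (hz : z ∈ B ∧ z ≠ w) := exists_dist_lt_of_reachable hopp hE (hconn z hz.1) hz.2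
  choose! parent hparent using hstep
  exact ⟨parent, fun z hz hzw => hparent z ⟨hz, hzw⟩⟩

/-- A set of darts that contains no two opposite darts and that can be left nowhere: every vertex
at which a dart of the set ends is the source of a dart of the set. -/
def IsTrap (opp : D → D) (src : D → W) (Z : Finset D) : Prop :=
  ∀ d ∈ Z, opp d ∉ Z ∧ ∃ d' ∈ Z, src d' = src (opp d)

variable {E : Finset D} {B : Finset W} {w : W}

theorem exists_dart_forall_reachable_sdiff [DecidableEq D] (hopp : Function.Involutive opp)
    (hE : ∀ d ∈ E, opp d ∈ E) (hB : ∀ d ∈ E, src d ∈ B) (hw : w ∈ B)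
    (hconn : ∀ z ∈ B, (dartGraph opp src E).Reachable z w) (hcard : 2 * B.card ≤ E.card) :
    ∃ e ∈ E, ∀ z ∈ B, (dartGraph opp src (E \ {e, opp e} : Finset D)).Reachable z w := by
  classical
  have : Nonempty D := by
    have : E.Nonempty := Finset.card_pos.1 (by have := Finset.card_pos.2 ⟨w, hw⟩; omega)
    exact ⟨this.choose⟩
  obtain ⟨parent, hparent⟩ := exists_parent_of_forall_reachable (B := (B : Set W)) hopp hE hconn
  let tree := (B.erase w).image parent
  obtain ⟨e, heE, he⟩ : ∃ e ∈ E, e ∉ tree ∪ tree.image opp := by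
    refine Finset.exists_mem_notMem_of_card_lt_card ?_
    have h₁ := Finset.card_union_le tree (tree.image opp)
    have h₂ : tree.card ≤ (B.erase w).card := Finset.card_image_le
    have h₃ : (tree.image opp).card ≤ tree.card := Finset.card_image_le
    have h₄ := Finset.card_erase_add_one hw
    omega
  have hrest {z : W} (hz : z ∈ B) (hzw : z ≠ w) : parent z ∈ (E \ {e, opp e} : Finset D) := by
    have htree : parent z ∈ tree :=
      Finset.mem_image_of_mem _ (Finset.mem_erase.2 ⟨hzw, hz⟩)
    simp only [Finset.mem_sdiff, Finset.mem_insert, Finset.mem_singleton, not_or]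
    refine ⟨(hparent z hz hzw).1, ?_, ?_⟩
    · exact fun h => he (h ▸ Finset.mem_union_left _ htree)
    · intro h
      have := Finset.mem_image_of_mem opp htree
      rw [h, hopp] at this
      exact he (Finset.mem_union_right _ this)
  refine ⟨e, heE, fun z => ?_⟩
  induction hn : (dartGraph opp src E).dist z w using Nat.strong_induction_on generalizing z with
  | _ n ih =>
    intro hz
    by_cases hzw : z = w
    · rw [hzw]
    · obtain ⟨hmem, hsrc, hlt⟩ := hparent z hz hzw
      have hnext := ih _ (hn ▸ hlt) _ rfl (hB _ (hE _ hmem))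
      have hfirst := reachable_dartGraph (opp := opp) (src := src)
        (Finset.mem_coe.2 (hrest hz hzw))
      rw [hsrc] at hfirst
      exact hfirst.trans hnext

theorem isTrap_image [DecidableEq D] {out : W → D} (hsrc : ∀ z ∈ B, src (out z) = z)
    (hmem : ∀ z ∈ B, src (opp (out z)) ∈ B) (hopp : ∀ z ∈ B, ∀ y ∈ B, opp (out z) ≠ out y) :
    IsTrap opp src (B.image out) := by
  refine Finset.forall_mem_image.2 fun z hz => ⟨fun h => ?_, ?_⟩
  · obtain ⟨y, hy, hyz⟩ := Finset.mem_image.1 h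
    exact hopp z hz y hy hyz.symm
  · exact ⟨out (src (opp (out z))), Finset.mem_image_of_mem _ (hmem z hz), hsrc _ (hmem z hz)⟩

theorem exists_isTrap_of_two_mul_card_le (hopp : Function.Involutive opp)
    (hne : ∀ d ∈ E, opp d ≠ d) (hE : ∀ d ∈ E, opp d ∈ E) (hB : ∀ d ∈ E, src d ∈ B) (hw : w ∈ B)
    (hconn : ∀ z ∈ B, (dartGraph opp src E).Reachable z w) (hcard : 2 * B.card ≤ E.card) :
    ∃ Z ⊆ E, IsTrap opp src Z ∧ ∀ z ∈ B, ∃ d ∈ Z, src d = z := by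
  classical
  obtain ⟨e, heE, hreach⟩ := exists_dart_forall_reachable_sdiff hopp hE hB hw hconn hcard
  set rest := E \ {e, opp e} with hrest
  have hmem_rest {d : D} : d ∈ rest ↔ d ∈ E ∧ d ≠ e ∧ d ≠ opp e := by
    simp only [hrest, Finset.mem_sdiff, Finset.mem_insert, Finset.mem_singleton, not_or]
  have hrest_opp : ∀ d ∈ rest, opp d ∈ rest := fun d hd =>
    have ⟨hdE, hde, hdoe⟩ := hmem_rest.1 hd
    hmem_rest.2 ⟨hE d hdE, fun h => hdoe (hopp.eq_iff.1 h), hopp.injective.ne hde⟩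
  have : Nonempty D := ⟨e⟩
  obtain ⟨parent, hparent⟩ := exists_parent_of_forall_reachable (B := B) (w := src e) hopp hrest_opp
    fun z hz => (hreach z hz).trans (hreach _ (hB e heE)).symm
  -- The tree of parents is rooted at the source of the dart `e` outside of it, so that the root
  -- can leave along `e`.
  let out (z : W) : D := if z = src e then e else parent z
  have hout (z : W) (hz : z ∈ B) : src (out z) = z ∧ out z ∈ E := by
    by_cases h : z = src e
    · rw [show out z = e from if_pos h]
      exact ⟨h.symm, heE⟩
    · rw [show out z = parent z from if_neg h]
      exact ⟨(hparent z hz h).2.1, (hmem_rest.1 (hparent z hz h).1).1⟩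
  have hout_opp (z : W) (hz : z ∈ B) (y : W) (hy : y ∈ B) : opp (out z) ≠ out y := by
    intro h
    by_cases hze : z = src e <;> by_cases hye : y = src e
    · simp only [out, if_pos hze, if_pos hye] at h
      exact hne e heE h
    · simp only [out, if_pos hze, if_neg hye] at h
      exact (hmem_rest.1 (hparent y hy hye).1).2.2 h.symm
    · simp only [out, if_neg hze, if_pos hye] at h
      exact (hmem_rest.1 (hparent z hz hze).1).2.2 (hopp.eq_iff.1 h)
    · simp only [out, if_neg hze, if_neg hye] at h
      obtain ⟨-, hsrc_z, hzy⟩ := hparent z hz hze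
      obtain ⟨-, hsrc_y, hyz⟩ := hparent y hy hye
      rw [h, hsrc_y] at hzy
      rw [← h, hopp, hsrc_z] at hyz
      exact lt_asymm hzy hyz
  exact ⟨B.image out, Finset.image_subset_iff.2 fun z hz => (hout z hz).2,
    isTrap_image (fun z hz => (hout z hz).1) (fun z hz => hB _ (hE _ (hout z hz).2)) hout_opp,
    fun z hz => ⟨out z, Finset.mem_image_of_mem _ hz, (hout z hz).1⟩⟩

theorem exists_two_mul_succ_le_three_mul {f : ℕ → ℕ} {l : ℕ} (h : 2 ^ l * f l < 3 ^ l * f 0) :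
    ∃ r < l, 2 * f (r + 1) ≤ 3 * f r := by
  by_contra! hgrow
  have hpow (r : ℕ) (hr : r ≤ l) : 3 ^ r * f 0 ≤ 2 ^ r * f r := by
    induction r with
    | zero => simp
    | succ r ih =>
      have := hgrow r hr
      calc 3 ^ (r + 1) * f 0 = 3 * (3 ^ r * f 0) := by ring
        _ ≤ 3 * (2 ^ r * f r) := Nat.mul_le_mul_left 3 (ih (Nat.le_of_succ_le hr))
        _ = 2 ^ r * (3 * f r) := by ring
        _ ≤ 2 ^ r * (2 * f (r + 1)) := by gcongr
        _ = 2 ^ (r + 1) * f (r + 1) := by ring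
  exact (hpow l le_rfl).not_gt h

theorem reachable_dartGraph_of_edist_le (hopp : Function.Involutive opp) {E F : Set D}
    (hE : ∀ d ∈ E, opp d ∈ E) {z w : W} {r : ℕ}
    (hF : ∀ d ∈ E, (dartGraph opp src E).edist (src d) w ≤ r →
      (dartGraph opp src E).edist (src (opp d)) w ≤ r → d ∈ F)
    (hzw : (dartGraph opp src E).edist z w ≤ r) : (dartGraph opp src F).Reachable z w := by
  have hreach {z : W} (hz : (dartGraph opp src E).edist z w ≤ r) :
      (dartGraph opp src E).Reachable z w :=
    SimpleGraph.reachable_of_edist_ne_top (hz.trans_lt (ENat.natCast_lt_top r)).ne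
  induction hn : (dartGraph opp src E).dist z w using Nat.strong_induction_on generalizing z with
  | _ n ih =>
    by_cases hne : z = w
    · rw [hne]
    · obtain ⟨d, hd, rfl, hlt⟩ := exists_dist_lt_of_reachable hopp hE (hreach hzw) hne
      have hnext : (dartGraph opp src E).edist (src (opp d)) w ≤ r := by
        have hr' : (dartGraph opp src E).Reachable (src (opp d)) w :=
          (reachable_dartGraph hd).symm.trans (hreach hzw)
        rw [← hr'.coe_dist_eq_edist]
        rw [← (hreach hzw).coe_dist_eq_edist] at hzw
        exact (Nat.cast_le.2 hlt.le).trans hzw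
      exact (reachable_dartGraph (hF d hd hzw hnext)).trans (ih _ (hn ▸ hlt) hnext rfl)

open Classical in
theorem two_mul_card_le_card_filter [DecidableEq W] {C : Finset W} {r : ℕ}
    (hdeg : ∀ z ∈ C, 3 ≤ (E.filter fun d => src d = z).card)
    (hgrow : 2 * (C.filter fun z => (dartGraph opp src E).edist z w ≤ (r + 1 : ℕ)).card ≤
      3 * (C.filter fun z => (dartGraph opp src E).edist z w ≤ r).card) :
    2 * (C.filter fun z => (dartGraph opp src E).edist z w ≤ (r + 1 : ℕ)).card ≤
      (E.filter fun d => (dartGraph opp src E).edist (src d) w ≤ (r + 1 : ℕ) ∧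
        (dartGraph opp src E).edist (src (opp d)) w ≤ (r + 1 : ℕ)).card := by
  set G := dartGraph opp src E
  let leaving : Finset D := E.filter fun d => src d ∈ C.filter fun z => G.edist z w ≤ r
  calc 2 * (C.filter fun z => G.edist z w ≤ (r + 1 : ℕ)).card
      ≤ 3 * (C.filter fun z => G.edist z w ≤ r).card := hgrow
    _ ≤ leaving.card := by
        refine Finset.mul_card_image_le_card_of_maps_to
          (fun d hd => (Finset.mem_filter.1 hd).2) 3 fun z hz => ?_
        rw [Finset.filter_filter]
        refine (hdeg z (Finset.mem_filter.1 hz).1).trans (Finset.card_le_card ?_)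
        exact Finset.monotone_filter_right E fun d _ hd => ⟨hd ▸ hz, hd⟩
    _ ≤ _ := by
        refine Finset.card_le_card (Finset.monotone_filter_right E fun d hd hdr => ?_)
        replace hdr := (Finset.mem_filter.1 hdr).2
        refine ⟨hdr.trans (Nat.cast_le.2 r.le_succ), ?_⟩
        calc G.edist (src (opp d)) w ≤ G.edist (src (opp d)) (src d) + G.edist (src d) w :=
              SimpleGraph.edist_triangle
          _ ≤ 1 + r := add_le_add
              (SimpleGraph.edist_comm.trans_le (edist_dartGraph_le_one hd)) hdr
          _ = (r + 1 : ℕ) := by rw [Nat.cast_add, Nat.cast_one, add_comm]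

open Classical in
theorem exists_isTrap [DecidableEq W] {C : Finset W} {l : ℕ} (hopp : Function.Involutive opp)
    (hne : ∀ d ∈ E, opp d ≠ d) (hE : ∀ d ∈ E, opp d ∈ E) (hC : ∀ d ∈ E, src d ∈ C)
    (hdeg : ∀ z ∈ C, 3 ≤ (E.filter fun d => src d = z).card) (hw : w ∈ C)
    (hl : 2 ^ l * C.card < 3 ^ l) :
    ∃ Z ⊆ E, IsTrap opp src Z ∧ (∃ d ∈ Z, src d = w) ∧
      ∀ d ∈ Z, (dartGraph opp src E).edist (src d) w ≤ l := by
  set G := dartGraph opp src E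
  let ball (r : ℕ) : Finset W := C.filter fun z => G.edist z w ≤ r
  have hcenter (r : ℕ) : w ∈ ball r :=
    Finset.mem_filter.2 ⟨hw, by simp only [SimpleGraph.edist_self, zero_le]⟩
  obtain ⟨r, hr, hgrow⟩ : ∃ r < l, 2 * (ball (r + 1)).card ≤ 3 * (ball r).card := by
    refine exists_two_mul_succ_le_three_mul (f := fun r => (ball r).card) ?_
    calc 2 ^ l * (ball l).card ≤ 2 ^ l * C.card := by gcongr; exact Finset.filter_subset _ _
      _ < 3 ^ l * 1 := by rwa [mul_one]
      _ ≤ 3 ^ l * (ball 0).card := by gcongr; exact Finset.card_pos.2 ⟨w, hcenter 0⟩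
  let inner : Finset D :=
    E.filter fun d => G.edist (src d) w ≤ (r + 1 : ℕ) ∧ G.edist (src (opp d)) w ≤ (r + 1 : ℕ)
  have hinner {d : D} (hd : d ∈ inner) := Finset.mem_filter.1 hd
  obtain ⟨Z, hZ, htrap, hcover⟩ := exists_isTrap_of_two_mul_card_le (E := inner) hopp
    (fun d hd => hne d (hinner hd).1)
    (fun d hd => Finset.mem_filter.2
      ⟨hE d (hinner hd).1, (hinner hd).2.2, by rw [hopp]; exact (hinner hd).2.1⟩)
    (fun d hd => Finset.mem_filter.2 ⟨hC d (hinner hd).1, (hinner hd).2.1⟩)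
    (hcenter (r + 1))
    (fun z hz => reachable_dartGraph_of_edist_le hopp hE
      (fun d hd h₁ h₂ => Finset.mem_filter.2 ⟨hd, h₁, h₂⟩) (Finset.mem_filter.1 hz).2)
    (two_mul_card_le_card_filter hdeg hgrow)
  exact ⟨Z, fun d hd => (hinner (hZ hd)).1, htrap, hcover w (hcenter (r + 1)),
    fun d hd => (hinner (hZ hd)).2.1.trans (Nat.cast_le.2 hr)⟩

end DartGraph

/-! ### Path systems -/

section PathSystem

variable {D V : Type*} {opp : D → D} {src : D → V} {F : D → List D} {m : D → D} {p q c d : D}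

/-- If the path that leaves through the dart `p` traverses the darts `F p`, then `far opp F p` is
the dart through which this path leaves from its other end. It is `p` if `F p` is empty, which
means that no path starts with `p`. -/
def far (opp : D → D) (F : D → List D) (p : D) : D := (F p).getLast?.elim p opp

/-- A partition of the edges into paths, each of which is recorded once from each of its two ends
as the list of the darts that it traverses. Here `opp` is an involution, whose fixed points are not
regarded as darts, and `F p` is the path with first dart `p`, or empty if there is none. -/
structure IsPathSystem (opp : D → D) (src : D → V) (F : D → List D) : Prop where
  head?_eq : ∀ p, F p ≠ [] → (F p).head? = some p
  chain : ∀ p, (F p).IsChain fun a b => src (opp a) = src b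
  far_ne : ∀ p, F p ≠ [] → far opp F p ≠ p
  reverse : ∀ p, F (far opp F p) = ((F p).map opp).reverse
  cover : ∀ d, opp d ≠ d ↔ ∃ p, d ∈ F p
  eq_of_mem : ∀ {d p q}, d ∈ F p → d ∈ F q → p = q
  nodup : ∀ p, (F p).Nodup

/-- The paths that start with a dart at `v`, each of them represented by this dart. -/
def ends (src : D → V) (F : D → List D) (v : V) : Set D := {p | F p ≠ [] ∧ src p = v}

theorem far_of_eq_nil (hp : F p = []) : far opp F p = p := by
  rw [far, hp, List.getLast?_nil, Option.elim_none]

theorem far_eq_opp (h : (F p).getLast? = some d) : far opp F p = opp d := by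
  rw [far, h, Option.elim_some]

open Classical in
/-- The path system in which each edge is a path. -/
noncomputable def edgePaths (opp : D → D) (p : D) : List D := if opp p = p then [] else [p]

theorem edgePaths_eq_nil_iff : edgePaths opp p = [] ↔ opp p = p := by
  simp only [edgePaths, ite_eq_left_iff, List.cons_ne_nil, imp_false, not_not]

theorem mem_edgePaths_iff : d ∈ edgePaths opp p ↔ opp d ≠ d ∧ d = p := by
  by_cases hp : opp p = p
  · rw [edgePaths_eq_nil_iff.2 hp]
    simp only [List.not_mem_nil, false_iff, not_and]
    rintro hd rfl
    exact hd hp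
  · rw [edgePaths, if_neg hp, List.mem_singleton]
    exact ⟨fun h => ⟨h ▸ hp, h⟩, And.right⟩

theorem edgePaths_eq_of_ne (hp : opp p ≠ p) : edgePaths opp p = [p] := if_neg hp

theorem far_edgePaths : far opp (edgePaths opp) p = opp p := by
  by_cases hp : opp p = p
  · rw [far_of_eq_nil (edgePaths_eq_nil_iff.2 hp), hp]
  · exact far_eq_opp (by rw [edgePaths_eq_of_ne hp, List.getLast?_singleton])

theorem isPathSystem_edgePaths (hopp : Function.Involutive opp) :
    IsPathSystem opp src (edgePaths opp) where
  head?_eq p hp := by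
    rw [edgePaths_eq_of_ne (edgePaths_eq_nil_iff.not.1 hp), List.head?_singleton]
  chain p := by
    by_cases hp : opp p = p
    · rw [edgePaths_eq_nil_iff.2 hp]; exact .nil
    · rw [edgePaths_eq_of_ne hp]; exact .singleton p
  far_ne p hp := by rw [far_edgePaths]; exact edgePaths_eq_nil_iff.not.1 hp
  reverse p := by
    rw [far_edgePaths]
    by_cases hp : opp p = p
    · rw [hp, edgePaths_eq_nil_iff.2 hp, List.map_nil, List.reverse_nil]
    · rw [edgePaths_eq_of_ne hp, edgePaths_eq_of_ne (hopp.injective.ne hp), List.map_singleton,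
        List.reverse_singleton]
  cover d := by simp only [mem_edgePaths_iff, exists_and_left, exists_eq', and_true]
  eq_of_mem hp hq := (mem_edgePaths_iff.1 hp).2.symm.trans (mem_edgePaths_iff.1 hq).2
  nodup p := by
    by_cases hp : opp p = p
    · rw [edgePaths_eq_nil_iff.2 hp]; exact List.nodup_nil
    · rw [edgePaths_eq_of_ne hp]; exact List.nodup_singleton p

namespace IsPathSystem

theorem self_mem (h : IsPathSystem opp src F) (hp : F p ≠ []) : p ∈ F p :=
  List.mem_of_mem_head? (h.head?_eq p hp)

theorem opp_ne (h : IsPathSystem opp src F) (hd : d ∈ F p) : opp d ≠ d := (h.cover d).2 ⟨p, hd⟩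

theorem far_ne_iff (h : IsPathSystem opp src F) : far opp F p ≠ p ↔ F p ≠ [] :=
  ⟨fun hp hnil => hp (far_of_eq_nil hnil), h.far_ne p⟩

theorem far_eq_nil_iff (h : IsPathSystem opp src F) : F (far opp F p) = [] ↔ F p = [] := by
  rw [h.reverse, List.reverse_eq_nil_iff, List.map_eq_nil_iff]

theorem opp_mem_far (h : IsPathSystem opp src F) (hd : d ∈ F p) : opp d ∈ F (far opp F p) := by
  rw [h.reverse, List.mem_reverse]
  exact List.mem_map_of_mem hd

theorem far_involutive (h : IsPathSystem opp src F) (hopp : Function.Involutive opp) :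
    Function.Involutive (far opp F) := by
  intro p
  by_cases hp : F p = []
  · rw [far_of_eq_nil hp, far_of_eq_nil hp]
  · have hlast : (F (far opp F p)).getLast? = some (opp p) := by
      rw [h.reverse, List.getLast?_reverse, List.head?_map, h.head?_eq p hp, Option.map_some]
    rw [far_eq_opp hlast, hopp]

end IsPathSystem

/-! ### Merging paths -/

/-- `m` pairs path ends at the same vertex, where a fixed point of `m` is left unpaired, and no
path is paired at both of its ends. -/
structure IsPairing (opp : D → D) (src : D → V) (F : D → List D) (m : D → D) : Prop where
  involutive : Function.Involutive m
  src_eq : ∀ p, src (m p) = src p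
  ne_nil : ∀ p, m p ≠ p → F p ≠ []
  apply_far : ∀ p, m p ≠ p → m (far opp F p) = far opp F p

open Classical in
/-- The paths that are obtained by joining each path of `F` with end `c` to the path with end
`m c`. -/
noncomputable def merge (opp : D → D) (F : D → List D) (m : D → D) (p : D) : List D :=
  if m p = p then F p ++ (if m (far opp F p) = far opp F p then [] else F (m (far opp F p))) else []

theorem merge_of_ne (hp : m p ≠ p) : merge opp F m p = [] := if_neg hp

theorem merge_of_apply_far_eq (hp : m p = p) (hfar : m (far opp F p) = far opp F p) :
    merge opp F m p = F p := by
  rw [merge, if_pos hp, if_pos hfar, List.append_nil]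

theorem merge_of_apply_far_ne (hp : m p = p) (hfar : m (far opp F p) ≠ far opp F p) :
    merge opp F m p = F p ++ F (m (far opp F p)) := by
  rw [merge, if_pos hp, if_neg hfar]

theorem merge_ne_nil_iff : merge opp F m p ≠ [] ↔ F p ≠ [] ∧ m p = p := by
  by_cases hp : m p = p
  · by_cases hnil : F p = []
    · rw [merge_of_apply_far_eq hp (by rwa [far_of_eq_nil hnil])]
      exact (and_iff_left hp).symm
    · rw [merge, if_pos hp]
      exact iff_of_true (List.append_ne_nil_of_left_ne_nil hnil _) ⟨hnil, hp⟩
  · simp only [merge_of_ne hp, ne_eq, not_true_eq_false, hp, and_false]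

theorem ends_merge (v : V) : ends src (merge opp F m) v = ends src F v \ {p | m p ≠ p} := by
  ext p
  simp only [ends, Set.mem_ofPred_eq, Set.mem_sdiff, merge_ne_nil_iff, not_not]
  exact and_right_comm

theorem length_merge_le {L : ℕ} (hL : ∀ p, (F p).length ≤ L) (p : D) :
    (merge opp F m p).length ≤ 2 * L := by
  by_cases hp : m p = p
  · by_cases hfar : m (far opp F p) = far opp F p
    · rw [merge_of_apply_far_eq hp hfar]
      exact (hL p).trans (Nat.le_mul_of_pos_left L two_pos)
    · rw [merge_of_apply_far_ne hp hfar, List.length_append, two_mul]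
      exact add_le_add (hL _) (hL _)
  · rw [merge_of_ne hp, List.length_nil]
    exact Nat.zero_le _

theorem exists_mem_of_mem_merge (hd : d ∈ merge opp F m p) : ∃ q, d ∈ F q := by
  by_cases hp : m p = p
  · by_cases hfar : m (far opp F p) = far opp F p
    · rw [merge_of_apply_far_eq hp hfar] at hd
      exact ⟨p, hd⟩
    · rw [merge_of_apply_far_ne hp hfar, List.mem_append] at hd
      exact hd.elim (fun h => ⟨_, h⟩) fun h => ⟨_, h⟩
  · rw [merge_of_ne hp] at hd
    exact absurd hd List.not_mem_nil

theorem far_merge_of_ne (hp : m p ≠ p) : far opp (merge opp F m) p = p :=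
  far_of_eq_nil (merge_of_ne hp)

theorem far_merge_of_apply_far_eq (hp : m p = p) (hfar : m (far opp F p) = far opp F p) :
    far opp (merge opp F m) p = far opp F p := by
  rw [far, merge_of_apply_far_eq hp hfar, far]

namespace IsPairing

theorem apply_apply_ne (hm : IsPairing opp src F m) (hp : m p ≠ p) : m (m p) ≠ m p :=
  hm.involutive.injective.ne hp

theorem far_merge_of_apply_far_ne (hm : IsPairing opp src F m) (hp : m p = p)
    (hfar : m (far opp F p) ≠ far opp F p) :
    far opp (merge opp F m) p = far opp F (m (far opp F p)) := by
  have hnil := hm.ne_nil _ (hm.apply_apply_ne hfar)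
  have hlast := List.getLast?_eq_some_getLast hnil
  rw [far_eq_opp hlast]
  refine far_eq_opp ?_
  rw [merge_of_apply_far_ne hp hfar, List.getLast?_append, hlast, Option.some_or]

end IsPairing

namespace IsPathSystem

open Classical in
theorem mem_merge_iff (h : IsPathSystem opp src F) (hopp : Function.Involutive opp)
    (hm : IsPairing opp src F m) (hd : d ∈ F c) :
    d ∈ merge opp F m q ↔ q = if m c = c then c else far opp F (m c) := by
  have hfar := h.far_involutive hopp
  constructor
  · intro hdq
    by_cases hq : m q = q
    · rw [merge, if_pos hq, List.mem_append] at hdq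
      rcases hdq with hdq | hdq
      · obtain rfl := h.eq_of_mem hd hdq
        rw [if_pos hq]
      · split_ifs at hdq with hfq
        · exact absurd hdq List.not_mem_nil
        · obtain rfl := h.eq_of_mem hd hdq
          rw [if_neg (hm.apply_apply_ne hfq), hm.involutive, hfar]
    · rw [merge_of_ne hq] at hdq
      exact absurd hdq List.not_mem_nil
  · rintro rfl
    split_ifs with hc
    · rw [merge, if_pos hc]
      exact List.mem_append_left _ hd
    · have hq := hm.apply_far _ (hm.apply_apply_ne hc)
      rw [merge_of_apply_far_ne hq] <;> rw [hfar, hm.involutive]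
      · exact List.mem_append_right _ hd
      · exact Ne.symm hc

theorem reverse_merge (h : IsPathSystem opp src F) (hopp : Function.Involutive opp)
    (hm : IsPairing opp src F m) (p : D) :
    merge opp F m (far opp (merge opp F m) p) = ((merge opp F m p).map opp).reverse := by
  have hfar := h.far_involutive hopp
  by_cases hp : m p = p
  · by_cases hfp : m (far opp F p) = far opp F p
    · rw [far_merge_of_apply_far_eq hp hfp, merge_of_apply_far_eq hp hfp,
        merge_of_apply_far_eq hfp (by rwa [hfar]), h.reverse]
    · have hc := hm.apply_apply_ne hfp
      rw [hm.far_merge_of_apply_far_ne hp hfp, merge_of_apply_far_ne hp hfp,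
        merge_of_apply_far_ne (hm.apply_far _ hc) (by rwa [hfar]), hfar, hm.involutive,
        h.reverse, h.reverse, List.map_append, List.reverse_append]
  · rw [far_merge_of_ne hp, merge_of_ne hp, List.map_nil, List.reverse_nil]

theorem chain_merge (h : IsPathSystem opp src F) (hm : IsPairing opp src F m) (p : D) :
    (merge opp F m p).IsChain fun a b => src (opp a) = src b := by
  by_cases hp : m p = p
  · by_cases hfar : m (far opp F p) = far opp F p
    · rw [merge_of_apply_far_eq hp hfar]
      exact h.chain p
    · rw [merge_of_apply_far_ne hp hfar, List.isChain_append]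
      refine ⟨h.chain _, h.chain _, fun a ha b hb => ?_⟩
      rw [h.head?_eq _ (hm.ne_nil _ (hm.apply_apply_ne hfar)), Option.mem_some_iff] at hb
      rw [← hb, hm.src_eq, far_eq_opp ha]
  · rw [merge_of_ne hp]
    exact .nil

theorem nodup_merge (h : IsPathSystem opp src F) (hm : IsPairing opp src F m) (p : D) :
    (merge opp F m p).Nodup := by
  by_cases hp : m p = p
  · by_cases hfar : m (far opp F p) = far opp F p
    · rw [merge_of_apply_far_eq hp hfar]
      exact h.nodup p
    · rw [merge_of_apply_far_ne hp hfar, List.nodup_append']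
      refine ⟨h.nodup _, h.nodup _, fun d hd hd' => ?_⟩
      have hpc := h.eq_of_mem hd hd'
      exact hm.apply_apply_ne hfar (by rw [← hpc, hp])
  · rw [merge_of_ne hp]
    exact List.nodup_nil

theorem far_merge_ne (h : IsPathSystem opp src F) (hopp : Function.Involutive opp)
    (hm : IsPairing opp src F m) (hp : merge opp F m p ≠ []) :
    far opp (merge opp F m) p ≠ p := by
  obtain ⟨hnil, hmp⟩ := merge_ne_nil_iff.1 hp
  by_cases hfar : m (far opp F p) = far opp F p
  · rw [far_merge_of_apply_far_eq hmp hfar]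
    exact h.far_ne p hnil
  · rw [hm.far_merge_of_apply_far_ne hmp hfar]
    exact fun hloop => hfar ((h.far_involutive hopp).eq_iff.1 hloop)

theorem merge (h : IsPathSystem opp src F) (hopp : Function.Involutive opp)
    (hm : IsPairing opp src F m) : IsPathSystem opp src (merge opp F m) where
  head?_eq p hp := by
    obtain ⟨hnil, hmp⟩ := merge_ne_nil_iff.1 hp
    rw [LocalModel.merge, if_pos hmp, List.head?_append, h.head?_eq p hnil, Option.some_or]
  chain := h.chain_merge hm
  far_ne _ hp := h.far_merge_ne hopp hm hp
  reverse := h.reverse_merge hopp hm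
  cover d := by
    rw [h.cover]
    refine ⟨fun ⟨c, hd⟩ => ?_, fun ⟨p, hd⟩ => exists_mem_of_mem_merge hd⟩
    classical exact ⟨_, (h.mem_merge_iff hopp hm hd).2 rfl⟩
  eq_of_mem hp hq := by
    obtain ⟨c, hd⟩ := exists_mem_of_mem_merge hp
    classical
    exact ((h.mem_merge_iff hopp hm hd).1 hp).trans ((h.mem_merge_iff hopp hm hd).1 hq).symm
  nodup := h.nodup_merge hm

end IsPathSystem

end PathSystem

/-! ### Choosing two ends at each vertex -/

section Selection

variable {D V W : Type*} {opp : D → D} {src : D → V} {F : D → List D} {𝒯 : Set (Finset D)}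

/-- The ways to leave the vertex `w` within a member of `𝒯`: a member of `𝒯` together with one of
its darts at `w`. -/
def exits (𝒯 : Set (Finset D)) (src : D → W) (w : W) : Set (Finset D × D) :=
  {x | x.1 ∈ 𝒯 ∧ x.2 ∈ x.1 ∧ src x.2 = w}

/-- The dart of an exit through the first possible set of darts, in a fixed enumeration of all
finite sets of darts. -/
noncomputable def firstExit [Encodable D] (A : Set (Finset D × D)) (hA : A.Nonempty) : D :=
  (Function.argminOn (fun x => Encodable.encode x.1) A hA).2

theorem src_firstExit [Encodable D] {src : D → W} {w : W} (hw : (exits 𝒯 src w).Nonempty) :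
    src (firstExit (exits 𝒯 src w) hw) = w :=
  (Function.argminOn_mem (fun x : Finset D × D => Encodable.encode x.1) _ hw).2.2

-- Opposite first exits would lie in the same trap: each of the two traps would be available at
-- both vertices, and both are the first available one.
theorem opp_firstExit_ne [Encodable D] {src : D → W} (hopp : Function.Involutive opp)
    (h𝒯 : ∀ Z ∈ 𝒯, IsTrap opp src Z) {w w' : W} (hw : (exits 𝒯 src w).Nonempty)
    (hw' : (exits 𝒯 src w').Nonempty) :
    opp (firstExit (exits 𝒯 src w) hw) ≠ firstExit (exits 𝒯 src w') hw' := by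
  intro heq
  let code (x : Finset D × D) : ℕ := Encodable.encode x.1
  obtain ⟨hZ, hd, hsrc⟩ := Function.argminOn_mem code _ hw
  obtain ⟨hZ', hd', hsrc'⟩ := Function.argminOn_mem code _ hw'
  set x := Function.argminOn code _ hw
  set x' := Function.argminOn code _ hw'
  have hxx' : opp x.2 = x'.2 := heq
  obtain ⟨-, e, he, hesrc⟩ := h𝒯 _ hZ _ hd
  obtain ⟨-, e', he', hesrc'⟩ := h𝒯 _ hZ' _ hd'
  have hle : code x' ≤ code x :=
    Function.argminOn_le code (exits 𝒯 src w') (a := (x.1, e))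
      ⟨hZ, he, by rw [hesrc, hxx', hsrc']⟩
  have hle' : code x ≤ code x' :=
    Function.argminOn_le code (exits 𝒯 src w) (a := (x'.1, e'))
      ⟨hZ', he', by rw [hesrc', ← hxx', hopp, hsrc]⟩
  have hsame : x.1 = x'.1 := Encodable.encode_injective (le_antisymm hle' hle)
  exact (h𝒯 _ hZ _ hd).1 (by rw [hxx', hsame]; exact hd')

open Classical in
/-- The permutation that exchanges the first exits in `A` and in `B`, if there are any. -/
noncomputable def swapFirstExits [Encodable D] (A B : Set (Finset D × D)) : Equiv.Perm D :=
  if h : A.Nonempty ∧ B.Nonempty then Equiv.swap (firstExit A h.1) (firstExit B h.2) else 1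

theorem swapFirstExits_apply_ne [Encodable D] {A B : Set (Finset D × D)} {c : D}
    (hc : swapFirstExits A B c ≠ c) :
    ∃ (hA : A.Nonempty) (hB : B.Nonempty),
      c = firstExit A hA ∧ swapFirstExits A B c = firstExit B hB ∨
      c = firstExit B hB ∧ swapFirstExits A B c = firstExit A hA := by
  classical
  rw [swapFirstExits] at hc ⊢
  split_ifs at hc ⊢ with h
  · exact ⟨h.1, h.2, (Equiv.swap_apply_ne_self_iff.1 hc).2.imp
      (fun hA => ⟨hA, by rw [hA, Equiv.swap_apply_left]⟩)
      (fun hB => ⟨hB, by rw [hB, Equiv.swap_apply_right]⟩)⟩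
  · exact absurd rfl hc

theorem involutive_swapFirstExits [Encodable D] (A B : Set (Finset D × D)) :
    Function.Involutive (swapFirstExits A B) := by
  classical
  intro c
  rw [swapFirstExits]
  split_ifs
  · exact Equiv.swap_apply_self _ _ c
  · rfl

theorem setOf_swapFirstExits_apply_ne [Encodable D] {A B : Set (Finset D × D)} (hA : A.Nonempty)
    (hB : B.Nonempty) (hne : firstExit A hA ≠ firstExit B hB) :
    {c | swapFirstExits A B c ≠ c} = {firstExit A hA, firstExit B hB} := by
  classical
  ext c
  rw [swapFirstExits, dif_pos ⟨hA, hB⟩]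
  exact Equiv.swap_apply_ne_self_iff.trans (and_iff_right hne)

/-- Each vertex `v` is split into two cells `(v, True)` and `(v, False)` by `cell`. The dart by
which one cell of a vertex is left first is paired with the one by which the other cell of this
vertex is left first. -/
noncomputable def exitPairing [Encodable D] (𝒯 : Set (Finset D)) (cell : D → V × Prop) (c : D) :
    D :=
  swapFirstExits (exits 𝒯 cell ((cell c).1, True)) (exits 𝒯 cell ((cell c).1, False)) c

section Pairing

variable [Encodable D] {cell : D → V × Prop} {c : D}

theorem exists_eq_firstExit_of_exitPairing_ne (hc : exitPairing 𝒯 cell c ≠ c) :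
    ∃ w hw, c = firstExit (exits 𝒯 cell w) hw := by
  obtain ⟨hA, hB, hc | hc⟩ := swapFirstExits_apply_ne hc
  · exact ⟨_, hA, hc.1⟩
  · exact ⟨_, hB, hc.1⟩

theorem fst_cell_exitPairing (c : D) : (cell (exitPairing 𝒯 cell c)).1 = (cell c).1 := by
  by_cases hc : exitPairing 𝒯 cell c = c
  · rw [hc]
  · obtain ⟨hA, hB, h | h⟩ := swapFirstExits_apply_ne hc
    · rw [exitPairing, h.2, src_firstExit hB]
    · rw [exitPairing, h.2, src_firstExit hA]

theorem involutive_exitPairing : Function.Involutive (exitPairing 𝒯 cell) := by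
  intro c
  rw [exitPairing, fst_cell_exitPairing]
  exact involutive_swapFirstExits _ _ c

theorem isPairing_exitPairing (h : IsPathSystem opp src F) (hopp : Function.Involutive opp)
    (h𝒯 : ∀ Z ∈ 𝒯, IsTrap (far opp F) cell Z) :
    IsPairing opp (fun d => (cell d).1) F (exitPairing 𝒯 cell) where
  involutive := involutive_exitPairing
  src_eq := fst_cell_exitPairing
  ne_nil c hc := by
    obtain ⟨w, hw, hcw⟩ := exists_eq_firstExit_of_exitPairing_ne hc
    rw [← h.far_ne_iff]
    intro hfar
    exact opp_firstExit_ne (h.far_involutive hopp) h𝒯 hw hw (by rw [← hcw, hfar])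
  apply_far c hc := by
    by_contra hfar
    obtain ⟨w, hw, hcw⟩ := exists_eq_firstExit_of_exitPairing_ne hc
    obtain ⟨w', hw', hcw'⟩ := exists_eq_firstExit_of_exitPairing_ne hfar
    exact opp_firstExit_ne (h.far_involutive hopp) h𝒯 hw hw' (by rw [← hcw, ← hcw'])

theorem ncard_setOf_exitPairing_ne {v : V} (hv : ∀ b, (exits 𝒯 cell (v, b)).Nonempty) :
    {c | (cell c).1 = v ∧ exitPairing 𝒯 cell c ≠ c}.ncard = 2 := by
  have hne : firstExit _ (hv True) ≠ firstExit _ (hv False) := by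
    intro heq
    have hcell := src_firstExit (hv True)
    rw [heq, src_firstExit (hv False), Prod.mk.injEq] at hcell
    exact false_ne_true hcell.2
  rw [← Set.ncard_pair hne, ← setOf_swapFirstExits_apply_ne (hv True) (hv False) hne]
  congr 1
  ext c
  refine ⟨?_, fun hc => ?_⟩
  · rintro ⟨rfl, hc⟩
    exact hc
  · obtain rfl : (cell c).1 = v := by
      obtain ⟨hA, hB, h | h⟩ := swapFirstExits_apply_ne hc
      · rw [h.1, src_firstExit hA]
      · rw [h.1, src_firstExit hB]
    exact ⟨rfl, hc⟩

end Pairing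

end Selection

/-! ### One round of joining paths -/

section Joining

variable {D V W : Type*} {opp : D → D} {src : D → V} {F : D → List D} {v : V} {L l R : ℕ}

theorem edist_le_mul {G : SimpleGraph V} {H : SimpleGraph W} {f : W → V}
    (hL : ∀ a b, H.Adj a b → G.edist (f a) (f b) ≤ L) {r : ℕ} {a b : W}
    (hab : H.edist a b ≤ r) : G.edist (f a) (f b) ≤ (L * r : ℕ) := by
  obtain ⟨p, hp⟩ := SimpleGraph.exists_walk_of_edist_ne_top
    (hab.trans_lt (ENat.natCast_lt_top r)).ne
  have hwalk : ∀ {a b : W} (p : H.Walk a b), G.edist (f a) (f b) ≤ (L * p.length : ℕ) := by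
    intro a b p
    induction p with
    | nil => simp only [SimpleGraph.edist_self, zero_le]
    | @cons a c b hac p ih =>
      calc G.edist (f a) (f b) ≤ G.edist (f a) (f c) + G.edist (f c) (f b) :=
            SimpleGraph.edist_triangle
        _ ≤ L + (L * p.length : ℕ) := add_le_add (hL a c hac) ih
        _ = (L * (p.length + 1) : ℕ) := by push_cast; ring
  refine (hwalk p).trans (Nat.cast_le.2 (Nat.mul_le_mul_left L ?_))
  rwa [← hp, Nat.cast_le] at hab

theorem edist_le_length_of_isChain {l : List D} (hl : l.IsChain fun a b => src (opp a) = src b)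
    {p : D} (hp : l.head? = some p) {d : D} (hd : d ∈ l) :
    (dartGraph opp src Set.univ).edist (src p) (src d) ≤ l.length ∧
      (dartGraph opp src Set.univ).edist (src p) (src (opp d)) ≤ l.length := by
  induction l generalizing p with
  | nil => exact absurd hd List.not_mem_nil
  | cons a t ih =>
    obtain rfl : a = p := Option.some_injective _ hp
    have hstep := edist_dartGraph_le_one (opp := opp) (src := src) (Set.mem_univ a)
    rw [List.length_cons]
    rcases List.mem_cons.1 hd with rfl | hd
    · refine ⟨by simp only [SimpleGraph.edist_self, zero_le], hstep.trans ?_⟩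
      exact_mod_cast Nat.le_add_left 1 t.length
    · obtain ⟨hhead, htail⟩ := List.isChain_cons.1 hl
      obtain ⟨b, hb⟩ := Option.isSome_iff_exists.1
        (List.isSome_head?.2 (List.ne_nil_of_mem hd))
      have hprepend {u : V} (hu : (dartGraph opp src Set.univ).edist (src b) u ≤ t.length) :
          (dartGraph opp src Set.univ).edist (src a) u ≤ (t.length + 1 : ℕ) := by
        rw [Nat.cast_add, Nat.cast_one, add_comm]
        rw [← hhead b hb] at hu
        exact SimpleGraph.edist_triangle.trans (add_le_add hstep hu)
      exact (ih htail hb hd).imp hprepend hprepend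

namespace IsPathSystem

variable (h : IsPathSystem opp src F) (hL : ∀ p, (F p).length ≤ L)
include h hL

theorem edist_src_le {p d : D} (hd : d ∈ F p) :
    (dartGraph opp src Set.univ).edist (src p) (src d) ≤ L :=
  (edist_le_length_of_isChain (h.chain p) (h.head?_eq p (List.ne_nil_of_mem hd)) hd).1.trans
    (Nat.cast_le.2 (hL p))

theorem edist_src_far_le (p : D) :
    (dartGraph opp src Set.univ).edist (src p) (src (far opp F p)) ≤ L := by
  by_cases hp : F p = []
  · rw [far_of_eq_nil hp, SimpleGraph.edist_self]
    exact zero_le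
  · rw [far_eq_opp (List.getLast?_eq_some_getLast hp)]
    exact (edist_le_length_of_isChain (h.chain p) (h.head?_eq p hp) (List.getLast_mem hp)).2.trans
      (Nat.cast_le.2 (hL p))

end IsPathSystem

/-- A subset of three elements. -/
noncomputable def triple (S : Set D) : Set D :=
  Classical.epsilon fun T => T ⊆ S ∧ T.ncard = 3

theorem triple_spec {S : Set D} (hS : 3 ≤ S.ncard) : triple S ⊆ S ∧ (triple S).ncard = 3 :=
  Classical.epsilon_spec (p := fun T => T ⊆ S ∧ T.ncard = 3) (Set.exists_subset_card_eq hS)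

/-- The path ends at a vertex `v` are distributed to two cells, `(v, True)` with three ends and
`(v, False)` with the others. -/
def cell (src : D → V) (F : D → List D) (d : D) : V × Prop :=
  (src d, d ∈ triple (ends src F (src d)))

theorem three_le_ncard_cell (hv : 6 ≤ (ends src F v).ncard) (b : Prop) :
    3 ≤ {d | F d ≠ [] ∧ cell src F d = (v, b)}.ncard := by
  have hfin : (ends src F v).Finite := Set.finite_of_ncard_pos (by omega)
  obtain ⟨hsub, hthree⟩ := triple_spec (S := ends src F v) (by omega)
  have hcells : {d | F d ≠ [] ∧ cell src F d = (v, b)}.Finite :=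
    hfin.subset fun d hd => ⟨hd.1, congrArg Prod.fst hd.2⟩
  by_cases hb : b
  · refine hthree.symm.le.trans (Set.ncard_le_ncard (fun d hd => ?_) hcells)
    obtain ⟨hd', rfl⟩ := hsub hd
    exact ⟨hd', Prod.ext rfl (propext (iff_of_true hd hb))⟩
  · have hrest := Set.ncard_sdiff_add_ncard_of_subset hsub hfin
    refine le_trans (by omega) (Set.ncard_le_ncard (s := ends src F v \ triple (ends src F v))
      (fun d hd => ?_) hcells)
    obtain ⟨⟨hd', rfl⟩, hnot⟩ := hd
    exact ⟨hd', Prod.ext rfl (propext (iff_of_false hnot hb))⟩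

/-- The traps of diameter at most `R` in the graph whose vertices are the cells and whose edges are
the paths. The diameter is measured in the underlying graph. -/
def smallTraps (opp : D → D) (src : D → V) (F : D → List D) (R : ℕ) : Set (Finset D) :=
  {Z | IsTrap (far opp F) (cell src F) Z ∧
    ∀ d ∈ Z, ∀ d' ∈ Z, (dartGraph opp src Set.univ).edist (src d) (src d') ≤ R}

theorem exits_smallTraps_nonempty (h : IsPathSystem opp src F) (hopp : Function.Involutive opp)
    (hL : ∀ p, (F p).length ≤ L) (hfin : {d | opp d ≠ d}.Finite) {nodes : Finset V}
    (hsrc : ∀ d, opp d ≠ d → src d ∈ nodes) (hends : ∀ v ∈ nodes, 6 ≤ (ends src F v).ncard)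
    (hl : 2 ^ l * (2 * nodes.card) < 3 ^ l) (hv : v ∈ nodes) (b : Prop) :
    (exits (smallTraps opp src F (L * (2 * l))) (cell src F) (v, b)).Nonempty := by
  classical
  have hfinF : {d | F d ≠ []}.Finite := hfin.subset fun d hd => h.opp_ne (h.self_mem hd)
  have hmem {d : D} : d ∈ hfinF.toFinset ↔ F d ≠ [] := hfinF.mem_toFinset
  have hdeg : ∀ z ∈ nodes ×ˢ Finset.univ,
      3 ≤ (hfinF.toFinset.filter fun d => cell src F d = z).card := by
    intro z hz
    rw [← Set.ncard_coe_finset]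
    convert three_le_ncard_cell (hends z.1 (Finset.mem_product.1 hz).1) z.2
    simp only [Finset.coe_filter, hmem]
  obtain ⟨Z, -, htrap, ⟨d, hd, hdv⟩, hdist⟩ := exists_isTrap (src := cell src F)
    (w := (v, b)) (h.far_involutive hopp)
    (fun d hd => h.far_ne d (hmem.1 hd))
    (fun d hd => hmem.2 (h.far_eq_nil_iff.not.2 (hmem.1 hd)))
    (fun d hd => Finset.mem_product.2
      ⟨hsrc d (h.opp_ne (h.self_mem (hmem.1 hd))), Finset.mem_univ _⟩)
    hdeg (Finset.mem_product.2 ⟨hv, Finset.mem_univ _⟩)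
    (by rwa [Finset.card_product, Finset.card_univ, Fintype.card_prop, mul_comm nodes.card])
  refine ⟨(Z, d), ⟨htrap, fun x hx y hy => ?_⟩, hd, hdv⟩
  have hlen {x : D} (hx : x ∈ Z) : (dartGraph opp src Set.univ).edist (src x) v ≤ (L * l : ℕ) := by
    refine edist_le_mul (f := Prod.fst) (fun a b hab => ?_) (hdist x hx)
    rcases hab.2 with ⟨d, -, rfl, rfl⟩ | ⟨d, -, rfl, rfl⟩
    · exact h.edist_src_far_le hL d
    · exact SimpleGraph.edist_comm.trans_le (h.edist_src_far_le hL d)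
  calc _ ≤ (dartGraph opp src Set.univ).edist (src x) v +
          (dartGraph opp src Set.univ).edist v (src y) := SimpleGraph.edist_triangle
    _ ≤ (L * l : ℕ) + (L * l : ℕ) :=
        add_le_add (hlen hx) (SimpleGraph.edist_comm.trans_le (hlen hy))
    _ = (L * (2 * l) : ℕ) := by push_cast; ring

/-- The path system that results from joining, at each vertex, two paths of `F` that are chosen
with the help of traps of diameter at most `R`. -/
noncomputable def joinPaths [Encodable D] (opp : D → D) (src : D → V) (F : D → List D) (R : ℕ) :
    D → List D :=
  merge opp F (exitPairing (smallTraps opp src F R) (cell src F))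

theorem isPathSystem_joinPaths [Encodable D] (h : IsPathSystem opp src F)
    (hopp : Function.Involutive opp) (R : ℕ) : IsPathSystem opp src (joinPaths opp src F R) :=
  h.merge hopp (isPairing_exitPairing (cell := cell src F) h hopp fun _ hZ => hZ.1)

theorem ncard_ends_joinPaths [Encodable D] (h : IsPathSystem opp src F)
    (hopp : Function.Involutive opp)
    (hv : ∀ b, (exits (smallTraps opp src F R) (cell src F) (v, b)).Nonempty)
    (hfin : (ends src F v).Finite) :
    (ends src (joinPaths opp src F R) v).ncard + 2 = (ends src F v).ncard := by
  have hpairing := isPairing_exitPairing (cell := cell src F) (𝒯 := smallTraps opp src F R) h hopp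
    fun _ hZ => hZ.1
  rw [joinPaths, ends_merge, ← ncard_setOf_exitPairing_ne hv]
  set m := exitPairing (smallTraps opp src F R) (cell src F)
  have hsub : {c | (cell src F c).1 = v ∧ m c ≠ c} ⊆ ends src F v :=
    fun c hc => ⟨hpairing.ne_nil c hc.2, hc.1⟩
  rw [← Set.ncard_sdiff_add_ncard_of_subset hsub hfin]
  congr 2
  ext c
  exact ⟨fun hc => ⟨hc.1, fun hc' => hc.2 hc'.2⟩, fun hc => ⟨hc.1, fun hc' => hc.2 ⟨hc.1.2, hc'⟩⟩⟩

end Joining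

/-! ### Networks on natural numbers and the locality of the path systems -/

/-- A multigraph on finitely many natural numbers with numbered ports: port `i` of the node `v` is
the dart `(v, i)`, and `opp d` is the other port of the edge at `d`, or `d` itself if `d` is not in
use. -/
structure Network where
  nodes : Finset ℕ
  opp : ℕ × ℕ → ℕ × ℕ
  opp_involutive : Function.Involutive opp
  fst_mem_nodes : ∀ d, opp d ≠ d → d.1 ∈ nodes
  finite_setOf_opp_ne : {d | opp d ≠ d}.Finite

namespace Network

variable {N N₁ N₂ : Network} {u v : ℕ} {L R r s t : ℕ}

/-- The underlying simple graph of a network. -/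
abbrev graph (N : Network) : SimpleGraph ℕ := dartGraph N.opp Prod.fst Set.univ

theorem exists_of_graph_adj (h : N.graph.Adj v u) : ∃ i, (N.opp (v, i)).1 = u := by
  obtain ⟨-, ⟨d, -, rfl, rfl⟩ | ⟨d, -, rfl, rfl⟩⟩ := h
  · exact ⟨d.2, rfl⟩
  · exact ⟨(N.opp d).2, congrArg Prod.fst (N.opp_involutive d)⟩

/-- Two networks look the same from the node `v` up to distance `t`: the ports of all nodes at
distance less than `t` are connected in the same way. -/
def Agree (N₁ N₂ : Network) : ℕ → ℕ → Prop
  | 0, _ => True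
  | t + 1, v => ∀ i, N₁.opp (v, i) = N₂.opp (v, i) ∧ Agree N₁ N₂ t (N₁.opp (v, i)).1

namespace Agree

theorem refl (v : ℕ) : Agree N N t v := by
  induction t generalizing v with
  | zero => trivial
  | succ t ih => exact fun i => ⟨rfl, ih _⟩

theorem symm (h : Agree N₁ N₂ t v) : Agree N₂ N₁ t v := by
  induction t generalizing v with
  | zero => trivial
  | succ t ih => exact fun i => ⟨(h i).1.symm, (h i).1 ▸ ih (h i).2⟩

theorem mono (hst : s ≤ t) (h : Agree N₁ N₂ t v) : Agree N₁ N₂ s v := by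
  induction s generalizing t v with
  | zero => trivial
  | succ s ih =>
    obtain ⟨t, rfl⟩ := Nat.exists_eq_add_of_le' (Nat.zero_lt_of_lt hst)
    exact fun i => ⟨(h i).1, ih (Nat.le_of_succ_le_succ hst) (h i).2⟩

theorem of_walk (p : N₁.graph.Walk v u) (h : Agree N₁ N₂ (p.length + t) v) :
    Agree N₁ N₂ t u ∧ N₂.graph.edist v u ≤ p.length := by
  induction p with
  | nil => exact ⟨by rwa [SimpleGraph.Walk.length_nil, zero_add] at h, by
      simp only [SimpleGraph.edist_self, zero_le]⟩
  | @cons v w u hvw p ih =>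
    obtain ⟨i, rfl⟩ := exists_of_graph_adj hvw
    rw [SimpleGraph.Walk.length_cons, add_right_comm] at h
    obtain ⟨hopp, hnext⟩ := h i
    refine ⟨(ih hnext).1, ?_⟩
    have hstep : N₂.graph.edist v (N₁.opp (v, i)).1 ≤ 1 := by
      rw [hopp]
      exact edist_dartGraph_le_one (Set.mem_univ (v, i))
    calc N₂.graph.edist v u ≤ N₂.graph.edist v (N₁.opp (v, i)).1 +
          N₂.graph.edist (N₁.opp (v, i)).1 u := SimpleGraph.edist_triangle
      _ ≤ 1 + p.length := add_le_add hstep (ih hnext).2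
      _ = (p.length + 1 : ℕ) := by rw [Nat.cast_add, Nat.cast_one, add_comm]

theorem of_edist_le (h : Agree N₁ N₂ (s + t) v) (hvu : N₁.graph.edist v u ≤ s) :
    Agree N₁ N₂ t u ∧ N₂.graph.edist v u ≤ s := by
  obtain ⟨p, hp⟩ := SimpleGraph.exists_walk_of_edist_ne_top
    (hvu.trans_lt (ENat.natCast_lt_top s)).ne
  have hps : p.length ≤ s := by rwa [← hp, Nat.cast_le] at hvu
  obtain ⟨hu, hdist⟩ := of_walk p (h.mono (Nat.add_le_add_right hps t))
  exact ⟨hu, hdist.trans (Nat.cast_le.2 hps)⟩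

theorem opp_eq {d : ℕ × ℕ} (h : Agree N₁ N₂ t d.1) (ht : 0 < t) : N₁.opp d = N₂.opp d := by
  obtain ⟨t, rfl⟩ := Nat.exists_eq_add_of_le' ht
  exact (h d.2).1

end Agree

/-- Two functions on ports, which are meant to be computed in the same way from two networks,
coincide at the ports of each node from which the networks look the same up to distance `r`. -/
def EqOfAgree {γ : Type*} (N₁ N₂ : Network) (r : ℕ) (f₁ f₂ : ℕ × ℕ → γ) : Prop :=
  ∀ d, Agree N₁ N₂ r d.1 → f₁ d = f₂ d

theorem EqOfAgree.symm {γ : Type*} {f₁ f₂ : ℕ × ℕ → γ} (h : EqOfAgree N₁ N₂ r f₁ f₂) :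
    EqOfAgree N₂ N₁ r f₂ f₁ :=
  fun d hd => (h d hd.symm).symm

theorem eqOfAgree_edgePaths (hr : 0 < r) :
    EqOfAgree N₁ N₂ r (edgePaths N₁.opp) (edgePaths N₂.opp) := by
  intro d hd
  rw [edgePaths, edgePaths, hd.opp_eq hr]

section PathSystems

variable {F₁ F₂ : ℕ × ℕ → List (ℕ × ℕ)}

theorem eqOfAgree_cell (hF : EqOfAgree N₁ N₂ r F₁ F₂) :
    EqOfAgree N₁ N₂ r (cell Prod.fst F₁) (cell Prod.fst F₂) := by
  intro d hd
  have hends : ends Prod.fst F₁ d.1 = ends Prod.fst F₂ d.1 := by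
    ext p
    refine and_congr_left fun hp => ?_
    rw [hF p (by rwa [hp])]
  rw [cell, cell, hends]

variable (h₁ : IsPathSystem N₁.opp Prod.fst F₁) (hL₁ : ∀ p, (F₁ p).length ≤ L)
  (hr : L < r) (hF : EqOfAgree N₁ N₂ r F₁ F₂)
include h₁ hL₁ hr hF

theorem eqOfAgree_far : EqOfAgree N₁ N₂ r (far N₁.opp F₁) (far N₂.opp F₂) := by
  intro p hp
  rw [far, far, ← hF p hp]
  cases hlast : (F₁ p).getLast? with
  | none => rfl
  | some d =>
    have hd := h₁.edist_src_le hL₁ (List.mem_of_getLast? hlast)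
    exact ((hp.mono hr).of_edist_le hd).1.opp_eq one_pos

theorem exits_smallTraps_subset (hv : Agree N₁ N₂ (L + r + 2 * R) v) (b : Prop) :
    exits (smallTraps N₁.opp Prod.fst F₁ R) (cell Prod.fst F₁) (v, b) ⊆
      exits (smallTraps N₂.opp Prod.fst F₂ R) (cell Prod.fst F₂) (v, b) := by
  rintro ⟨Z, d⟩ ⟨⟨htrap, hdiam⟩, hd, hdv⟩
  obtain rfl : d.1 = v := congrArg Prod.fst hdv
  have hZ {x : ℕ × ℕ} (hx : x ∈ Z) : Agree N₁ N₂ (L + r + R) x.1 :=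
    ((hv.mono (by omega)).of_edist_le (hdiam d hd x hx)).1
  have hcell {x : ℕ × ℕ} (hx : x ∈ Z) := eqOfAgree_cell hF x ((hZ hx).mono (by omega))
  have hfar {x : ℕ × ℕ} (hx : x ∈ Z) := eqOfAgree_far h₁ hL₁ hr hF x ((hZ hx).mono (by omega))
  have hcell_far {x : ℕ × ℕ} (hx : x ∈ Z) :=
    eqOfAgree_cell hF _ (((hZ hx).mono (by omega)).of_edist_le (h₁.edist_src_far_le hL₁ x)).1
  refine ⟨⟨fun x hx => ?_, fun x hx y hy => ?_⟩, hd, (hcell hd).symm.trans hdv⟩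
  · rw [← hfar hx, ← hcell_far hx]
    obtain ⟨hnot, y, hy, hyx⟩ := htrap x hx
    exact ⟨hnot, y, hy, (hcell hy).symm.trans hyx⟩
  · exact (((hZ hx).mono (by omega)).of_edist_le (t := 0) (hdiam x hx y hy)).2

variable (h₂ : IsPathSystem N₂.opp Prod.fst F₂) (hL₂ : ∀ p, (F₂ p).length ≤ L)
include h₂ hL₂

theorem eqOfAgree_exitPairing (R : ℕ) :
    EqOfAgree N₁ N₂ (L + r + 2 * R)
      (exitPairing (smallTraps N₁.opp Prod.fst F₁ R) (cell Prod.fst F₁))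
      (exitPairing (smallTraps N₂.opp Prod.fst F₂ R) (cell Prod.fst F₂)) := by
  intro d hd
  have hexits (b : Prop) := (exits_smallTraps_subset h₁ hL₁ hr hF hd b).antisymm
    (exits_smallTraps_subset h₂ hL₂ hr hF.symm hd.symm b)
  have hfst (F : ℕ × ℕ → List (ℕ × ℕ)) : (cell Prod.fst F d).1 = d.1 := rfl
  simp only [exitPairing, hfst, hexits]

theorem eqOfAgree_joinPaths (R : ℕ) :
    EqOfAgree N₁ N₂ (r + 2 * L + 2 * R) (joinPaths N₁.opp Prod.fst F₁ R)
      (joinPaths N₂.opp Prod.fst F₂ R) := by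
  intro p hp
  have hpairing := eqOfAgree_exitPairing h₁ hL₁ hr hF h₂ hL₂ R
  have hfar := eqOfAgree_far h₁ hL₁ hr hF p (hp.mono (by omega))
  have hp_far : Agree N₁ N₂ (L + r + 2 * R) (far N₁.opp F₁ p).1 :=
    ((hp.mono (by omega)).of_edist_le (h₁.edist_src_far_le hL₁ p)).1
  have hm := hpairing _ hp_far
  have hsrc := (isPairing_exitPairing (cell := cell Prod.fst F₁) h₁ N₁.opp_involutive
    fun _ (hZ : _ ∈ smallTraps N₁.opp Prod.fst F₁ R) => hZ.1).src_eq (far N₁.opp F₁ p)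
  have hnext := hF _ ((congrArg (Agree N₁ N₂ r) hsrc).mpr (hp_far.mono (by omega)))
  rw [joinPaths, joinPaths, merge, merge, ← hfar, ← hm, ← hnext, ← hF p (hp.mono (by omega)),
    ← hpairing p (hp.mono (by omega))]

end PathSystems

/-- The path system after `k` rounds of joining, where `l` bounds the radius of the traps in terms
of the number of paths. -/
noncomputable def paths (N : Network) (l : ℕ) : ℕ → ℕ × ℕ → List (ℕ × ℕ)
  | 0 => edgePaths N.opp
  | k + 1 => joinPaths N.opp Prod.fst (N.paths l k) (2 ^ k * (2 * l))

variable (N) (l k : ℕ)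

theorem isPathSystem_paths : IsPathSystem N.opp Prod.fst (N.paths l k) := by
  induction k with
  | zero => exact isPathSystem_edgePaths N.opp_involutive
  | succ k ih => exact isPathSystem_joinPaths ih N.opp_involutive _

theorem length_paths_le (p : ℕ × ℕ) : (N.paths l k p).length ≤ 2 ^ k := by
  induction k generalizing p with
  | zero =>
    rw [paths, edgePaths]
    split_ifs <;> simp only [List.length_nil, List.length_singleton, pow_zero, zero_le, le_refl]
  | succ k ih =>
    rw [pow_succ']
    exact length_merge_le ih p

variable {N l k}

theorem ncard_ends_paths (hl : 2 ^ l * (2 * N.nodes.card) < 3 ^ l)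
    (hdeg : ∀ v ∈ N.nodes, 2 * k + 4 ≤ {i | N.opp (v, i) ≠ (v, i)}.ncard) (hv : v ∈ N.nodes) :
    (ends Prod.fst (N.paths l k) v).ncard + 2 * k = {i | N.opp (v, i) ≠ (v, i)}.ncard := by
  induction k generalizing v with
  | zero =>
    rw [mul_zero, add_zero,
      ← Set.ncard_image_of_injective {i | N.opp (v, i) ≠ (v, i)} (Prod.mk_right_injective v)]
    refine congrArg Set.ncard (Set.ext fun d => ?_)
    simp only [ends, paths, ne_eq, edgePaths_eq_nil_iff, Set.mem_ofPred_eq, Set.mem_image]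
    constructor
    · rintro ⟨hd, rfl⟩
      exact ⟨d.2, hd, rfl⟩
    · rintro ⟨i, hi, rfl⟩
      exact ⟨hi, rfl⟩
  | succ k ih =>
    replace ih {v : ℕ} := ih (v := v) fun v hv => (by omega : _ ≤ 2 * (k + 1) + 4).trans (hdeg v hv)
    have hpaths := N.isPathSystem_paths l k
    have hexits := exits_smallTraps_nonempty hpaths N.opp_involutive (N.length_paths_le l k)
      N.finite_setOf_opp_ne N.fst_mem_nodes
      (fun v hv => by have := ih hv; have := hdeg v hv; omega) hl hv
    have hjoin := ncard_ends_joinPaths hpaths N.opp_involutive hexits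
      (N.finite_setOf_opp_ne.subset fun d hd => hpaths.opp_ne (hpaths.self_mem hd.1))
    rw [← ih hv, ← hjoin, paths, mul_add, mul_one, add_assoc, add_comm 2]

theorem eqOfAgree_paths (N₁ N₂ : Network) (l k : ℕ) :
    EqOfAgree N₁ N₂ (2 ^ k * (4 * l + 2)) (N₁.paths l k) (N₂.paths l k) := by
  induction k with
  | zero => exact eqOfAgree_edgePaths (by omega)
  | succ k ih =>
    have hr : 2 ^ k < 2 ^ k * (4 * l + 2) := lt_mul_right (by positivity) (by omega)
    have hjoin := eqOfAgree_joinPaths (N₁.isPathSystem_paths l k) (N₁.length_paths_le l k) hr ih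
      (N₂.isPathSystem_paths l k) (N₂.length_paths_le l k) (2 ^ k * (2 * l))
    rwa [show 2 ^ k * (4 * l + 2) + 2 * 2 ^ k + 2 * (2 ^ k * (2 * l)) =
      2 ^ (k + 1) * (4 * l + 2) by ring] at hjoin

end Network

/-! ### From path systems to path decompositions -/

section Trace

variable {D V β : Type*} {opp : D → D} {src : D → V} {e : D → β} {F : D → List D} {p d : D} {v : V}
  {L : ℕ}

/-- The path of the path system `F` with first dart `p`, where `e d` is the edge of the dart `d`. -/
def trace (opp : D → D) (src : D → V) (e : D → β) (F : D → List D) (p : D) : EdgePath V β where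
  start := src p
  steps := (F p).map fun d => (e d, src (opp d))

theorem edges_trace : (trace opp src e F p).edges = (F p).map e := by
  rw [EdgePath.edges, trace, List.map_map]
  rfl

theorem vertices_trace :
    (trace opp src e F p).vertices = src p :: (F p).map fun d => src (opp d) := by
  rw [EdgePath.vertices, trace, List.map_map]
  rfl

theorem finish_trace : (trace opp src e F p).finish = src (far opp F p) := by
  refine Option.some_injective _ ?_
  refine (List.getLast?_eq_some_getLast (List.cons_ne_nil _ _)).symm.trans ?_
  change (trace opp src e F p).vertices.getLast? = _
  rw [vertices_trace, List.getLast?_cons, List.getLast?_map, far]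
  cases (F p).getLast? <;> rfl

theorem IsPathSystem.edist_src_le_of_mem_vertices_trace (h : IsPathSystem opp src F)
    (hL : ∀ p, (F p).length ≤ L) (hv : v ∈ (trace opp src e F p).vertices) :
    (dartGraph opp src Set.univ).edist (src p) v ≤ L := by
  rw [vertices_trace, List.mem_cons, List.mem_map] at hv
  obtain rfl | ⟨d, hd, rfl⟩ := hv
  · simp only [SimpleGraph.edist_self, zero_le]
  · exact (edist_le_length_of_isChain (h.chain p) (h.head?_eq p (List.ne_nil_of_mem hd)) hd).2.trans
      (Nat.cast_le.2 (hL p))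

theorem IsPathSystem.exists_comap {D' V' : Type*} {opp' : D' → D'} {src' : D' → V'}
    {F' : D' → List D'} (h : IsPathSystem opp' src' F') {f : D → D'} (hf : Function.Injective f)
    (hopp : ∀ d, opp' (f d) = f (opp d)) (hsrc : ∀ a b, src' (f a) = src' (f b) → src a = src b)
    (hrange : ∀ d, opp' d ≠ d → d ∈ Set.range f) :
    ∃ F : D → List D, (∀ p, (F p).map f = F' (f p)) ∧ (∀ p, f (far opp F p) = far opp' F' (f p)) ∧
      IsPathSystem opp src F := by
  have hlift (p : D) : ∃ l : List D, l.map f = F' (f p) := by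
    change F' (f p) ∈ Set.range (List.map f)
    rw [Set.range_list_map]
    exact fun d hd => hrange d ((h.cover d).2 ⟨f p, hd⟩)
  choose F hF using hlift
  have hmem {d p : D} : d ∈ F p ↔ f d ∈ F' (f p) := by
    rw [← hF, List.mem_map_of_injective hf]
  have hnil {p : D} : F p ≠ [] ↔ F' (f p) ≠ [] := by rw [← hF, ne_eq, ne_eq, List.map_eq_nil_iff]
  have hfar (p : D) : f (far opp F p) = far opp' F' (f p) := by
    rw [far, far, ← hF, List.getLast?_map]
    cases (F p).getLast? with
    | none => rfl
    | some d => exact (hopp d).symm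
  refine ⟨F, hF, hfar, fun p hp => ?_, fun p => ?_, fun p hp hfarp => ?_, fun p => ?_, fun d => ?_,
    fun hp hq => hf (h.eq_of_mem (hmem.1 hp) (hmem.1 hq)), fun p => ?_⟩
  · have hhead := h.head?_eq _ (hnil.1 hp)
    rw [← hF, List.head?_map] at hhead
    exact Option.map_injective hf hhead
  · have hchain := h.chain (f p)
    rw [← hF, List.isChain_map] at hchain
    exact hchain.imp fun a b hab => hsrc _ _ (hopp a ▸ hab)
  · exact h.far_ne _ (hnil.1 hp) (by rw [← hfar, hfarp])
  · refine List.map_injective_iff.2 hf ?_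
    rw [hF, hfar, h.reverse, ← hF, List.map_reverse, List.map_map, List.map_map]
    exact congrArg List.reverse (List.map_congr_left fun d _ => hopp d)
  · rw [← hf.ne_iff, ← hopp, h.cover]
    constructor
    · rintro ⟨p, hp⟩
      obtain ⟨p, rfl⟩ := hrange p (h.opp_ne (h.self_mem (List.ne_nil_of_mem hp)))
      exact ⟨p, hmem.2 hp⟩
    · rintro ⟨p, hp⟩
      exact ⟨f p, hmem.1 hp⟩
  · exact List.Nodup.of_map f (hF p ▸ h.nodup (f p))

end Trace

namespace PortNumbering

variable {α β : Type*} {G : Graph α β} (π : PortNumbering G)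

theorem isWalkFrom_of_isChain {l : List (Port G)} (hl : l.IsChain fun a b => (π.opp a).1 = b.1)
    {u : α} (hu : u ∈ V(G)) (hhead : ∀ p ∈ l.head?, p.1 = u) :
    IsWalkFrom G u (l.map fun d => (π.edge d, (π.opp d).1)) := by
  induction l generalizing u with
  | nil => exact hu
  | cons d l ih =>
    obtain ⟨hnext, hl⟩ := List.isChain_cons.1 hl
    obtain rfl := hhead d rfl
    exact ⟨π.isLink d, ih hl (π.isLink d).right_mem fun p hp => (hnext p hp).symm⟩

variable {F : Port G → List (Port G)} {H : Set (Port G)} {L : ℕ}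
  (h : IsPathSystem π.opp Sigma.fst F)
include h

theorem isPathIn_trace {p : Port G} (hp : F p ≠ []) :
    IsPathIn G (trace π.opp Sigma.fst π.edge F p) where
  walk := π.isWalkFrom_of_isChain (h.chain p) (π.isLink p).left_mem fun q hq => by
    rw [h.head?_eq p hp, Option.mem_some_iff] at hq
    exact congrArg Sigma.fst hq.symm
  nodup := by
    rw [edges_trace]
    refine (h.nodup p).map_on fun a ha b hb hab => ?_
    rcases (π.edge_eq_iff a b).1 hab with rfl | rfl
    · rfl
    · exact absurd (h.eq_of_mem (h.opp_mem_far ha) hb) (h.far_ne p hp)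
  ne_nil := fun hnil => hp (List.map_eq_nil_iff.1 hnil)

theorem existsUnique_mem_edges_trace (hH : ∀ p, F p ≠ [] → (far π.opp F p ∈ H ↔ p ∉ H))
    {e : β} (he : e ∈ E(G)) :
    ∃! q, (∃ p ∈ H, F p ≠ [] ∧ trace π.opp Sigma.fst π.edge F p = q) ∧ e ∈ q.edges := by
  obtain ⟨d, rfl⟩ := π.edge_surj e he
  have hedge {p d : Port G} (hd : d ∈ F p) :
      π.edge d ∈ (trace π.opp Sigma.fst π.edge F p).edges := by
    rw [edges_trace]
    exact List.mem_map_of_mem hd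
  obtain ⟨p, hpH, d', hd', hdd'⟩ : ∃ p ∈ H, ∃ d' ∈ F p, π.edge d' = π.edge d := by
    obtain ⟨p, hp⟩ := (h.cover d).1 (π.opp_ne d)
    by_cases hpH : p ∈ H
    · exact ⟨p, hpH, d, hp, rfl⟩
    · exact ⟨far π.opp F p, (hH p (List.ne_nil_of_mem hp)).2 hpH, π.opp d, h.opp_mem_far hp,
        (π.edge_eq_iff _ _).2 (.inr (π.opp_opp d).symm)⟩
  rw [← hdd']
  refine ⟨_, ⟨⟨p, hpH, List.ne_nil_of_mem hd', rfl⟩, hedge hd'⟩, ?_⟩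
  rintro _ ⟨⟨q, hqH, hq, rfl⟩, he⟩
  rw [edges_trace, List.mem_map] at he
  obtain ⟨a, ha, had⟩ := he
  rcases (π.edge_eq_iff a d').1 had with rfl | rfl
  · rw [h.eq_of_mem hd' ha]
  · rw [h.eq_of_mem hd' (h.opp_mem_far ha)] at hpH
    exact absurd hqH ((hH q hq).1 hpH)

theorem isPathDecomposition_of_isPathSystem (hL : ∀ p, (F p).length ≤ L)
    (hH : ∀ p, F p ≠ [] → (far π.opp F p ∈ H ↔ p ∉ H))
    {P : Finset (EdgePath α β)}
    (hP : ∀ q, q ∈ P ↔ ∃ p ∈ H, F p ≠ [] ∧ trace π.opp Sigma.fst π.edge F p = q) :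
    IsPathDecomposition G (fun v => (ends Sigma.fst F v).ncard) L P where
  isPath q hq := by
    obtain ⟨p, -, hp, rfl⟩ := (hP q).1 hq
    exact π.isPathIn_trace h hp
  partition e he := by
    simp only [hP]
    exact π.existsUnique_mem_edges_trace h hH he
  length_le q hq := by
    obtain ⟨p, -, -, rfl⟩ := (hP q).1 hq
    exact (List.length_map _).trans_le (hL p)
  ends_le v _ := by
    have hfin : (ends Sigma.fst F v).Finite := by
      refine (Set.finite_range (Sigma.mk v)).subset ?_
      rintro ⟨_, i⟩ ⟨-, rfl⟩
      exact ⟨i, rfl⟩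
    rw [Nat.cast_le, ← Set.ncard_inter_add_ncard_sdiff_eq_ncard _ H hfin]
    refine add_le_add
      ((Set.ncard_le_ncard (t := trace π.opp Sigma.fst π.edge F '' (ends Sigma.fst F v ∩ H)) ?_
        ((hfin.inter_of_left H).image _)).trans (Set.ncard_image_le (hfin.inter_of_left H)))
      ((Set.ncard_le_ncard (t := (fun p => trace π.opp Sigma.fst π.edge F (far π.opp F p)) ''
        (ends Sigma.fst F v \ H)) ?_ (hfin.sdiff.image _)).trans (Set.ncard_image_le hfin.sdiff))
    · rintro q ⟨hq, hqv⟩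
      obtain ⟨p, hpH, hp, rfl⟩ := (hP q).1 hq
      exact ⟨p, ⟨⟨hp, hqv⟩, hpH⟩, rfl⟩
    · rintro q ⟨hq, hqv⟩
      obtain ⟨p, hpH, hp, rfl⟩ := (hP q).1 hq
      have hopp : Function.Involutive π.opp := π.opp_opp
      rw [finish_trace] at hqv
      refine ⟨far π.opp F p, ⟨⟨h.far_eq_nil_iff.not.2 hp, hqv⟩, fun hfar => ?_⟩, ?_⟩
      · exact (hH p hp).1 hfar hpH
      · beta_reduce
        rw [h.far_involutive hopp p]

theorem exists_isPathDecomposition_of_isPathSystem [Finite (Port G)]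
    (hL : ∀ p, (F p).length ≤ L) {code : Port G → ℕ} (hcode : Function.Injective code) :
    ∃ P, IsPathDecomposition G (fun v => (ends Sigma.fst F v).ncard) L P ∧
      ∀ q, q ∈ P ↔ ∃ p, code p < code (far π.opp F p) ∧ F p ≠ [] ∧
        trace π.opp Sigma.fst π.edge F p = q := by
  let H : Set (Port G) := {p | code p < code (far π.opp F p)}
  have hH (p : Port G) (hp : F p ≠ []) : far π.opp F p ∈ H ↔ p ∉ H := by
    have hne := hcode.ne (h.far_ne p hp)
    simp only [H, Set.mem_ofPred_eq, h.far_involutive π.opp_opp p]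
    omega
  have hfin := (Set.toFinite {p | p ∈ H ∧ F p ≠ []}).image (trace π.opp Sigma.fst π.edge F)
  have hmem (q : EdgePath α β) : q ∈ hfin.toFinset ↔
      ∃ p ∈ H, F p ≠ [] ∧ trace π.opp Sigma.fst π.edge F p = q := by
    rw [hfin.mem_toFinset, Set.mem_image]
    exact exists_congr fun p => and_assoc
  exact ⟨hfin.toFinset, π.isPathDecomposition_of_isPathSystem h hL hH hmem, hmem⟩

end PortNumbering

/-! ### Collecting the view of a node -/

instance : Nonempty Network :=
  ⟨⟨∅, id, fun _ => rfl, fun _ h => absurd rfl h, by simp only [id_eq, ne_eq, not_true_eq_false,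
    Set.ofPred_false, Set.finite_empty]⟩⟩

/-- What a node knows of the network while it collects information: the number of all nodes, its own
identifier, and the set of the networks that are consistent with the messages so far. -/
structure View where
  card : ℕ
  node : ℕ
  networks : Set Network

/-- The message that arrives at port `i` in a round. An unused port behaves as if it were connected
to itself. -/
def View.message (s : View) {deg : ℕ} (m : Fin deg → (ℕ × ℕ) × Set Network) (i : ℕ) :
    (ℕ × ℕ) × Set Network :=
  if h : i < deg then m ⟨i, h⟩ else ((s.node, i), s.networks)

/-- In each round every node sends its view, labelled with the port through which it is sent. After
`T n` rounds, a node evaluates `f` on an arbitrary network with `n` nodes that is consistent with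
its view. -/
noncomputable def collectAlgorithm {Out : Type} (T : ℕ → ℕ) (f : Network → ℕ → Out) :
    LocalAlgorithm Out where
  State := View
  Msg := (ℕ × ℕ) × Set Network
  init n ident _ := ⟨n, ident, Set.univ⟩
  send s i := ((s.node, i), s.networks)
  receive s _ m := { s with
    networks := {N | ∀ i, N.opp (s.node, i) = (s.message m i).1 ∧ N ∈ (s.message m i).2} }
  output s := f (Classical.epsilon fun N => N.nodes.card = s.card ∧ N ∈ s.networks) s.node
  rounds := T

/-- The value of `f` at a node is determined by the number `n` of nodes and by the part of the
network up to distance `T n` from the node. -/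
def IsLocal {γ : Type*} (T : ℕ → ℕ) (f : Network → ℕ → γ) : Prop :=
  ∀ n N₁ N₂ v, N₁.nodes.card = n → N₂.nodes.card = n → N₁.Agree N₂ (T n) v → f N₁ v = f N₂ v

namespace PortNumbering

variable {α β : Type*} {G : Graph α β} (π : PortNumbering G) {ident : α → ℕ}
  (hident : Set.InjOn ident V(G)) {v : α}

include hident in
theorem portName_injective : Function.Injective (π.portName ident) := by
  rintro ⟨v, i⟩ ⟨w, j⟩ hvw
  obtain ⟨hident_eq, hij⟩ := Prod.mk.inj hvw
  obtain rfl := hident (π.isLink ⟨v, i⟩).left_mem (π.isLink ⟨w, j⟩).left_mem hident_eq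
  exact congrArg (Sigma.mk v) (Fin.ext hij)

/-- The involution of the names of the ports that is induced by `π.opp`. Names that do not occur are
fixed. -/
noncomputable def namedOpp (ident : α → ℕ) : ℕ × ℕ → ℕ × ℕ :=
  Function.extend (π.portName ident) (fun p => π.portName ident (π.opp p)) id

section
include hident

theorem namedOpp_portName (p : Port G) :
    π.namedOpp ident (π.portName ident p) = π.portName ident (π.opp p) :=
  (π.portName_injective hident).extend_apply _ _ p

theorem namedOpp_ne_iff {d : ℕ × ℕ} :
    π.namedOpp ident d ≠ d ↔ d ∈ Set.range (π.portName ident) := by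
  constructor
  · intro hd
    by_contra hp
    exact hd (Function.extend_apply' _ _ _ hp)
  · rintro ⟨p, rfl⟩
    rw [π.namedOpp_portName hident]
    exact (π.portName_injective hident).ne (π.opp_ne p)

theorem namedOpp_involutive : Function.Involutive (π.namedOpp ident) := by
  intro d
  by_cases hd : π.namedOpp ident d = d
  · rw [hd, hd]
  · obtain ⟨p, rfl⟩ := (π.namedOpp_ne_iff hident).1 hd
    rw [π.namedOpp_portName hident, π.namedOpp_portName hident, π.opp_opp]

end

include π in
theorem finite_port (hV : V(G).Finite) : Finite (Port G) := by
  have := hV.to_subtype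
  let toVertex (p : Port G) : Σ v : V(G), Fin (degree G v) :=
    ⟨⟨p.1, (π.isLink p).left_mem⟩, p.2⟩
  refine Finite.of_injective toVertex ?_
  rintro ⟨v, i⟩ ⟨w, j⟩ hvw
  obtain ⟨hvw, hij⟩ := Sigma.mk.inj hvw
  obtain rfl := congrArg Subtype.val hvw
  exact congrArg (Sigma.mk v) (eq_of_heq hij)

open Classical in
/-- The network of the identifiers and port numbers of a finite multigraph. -/
noncomputable def toNetwork (hV : V(G).Finite) : Network where
  nodes := hV.toFinset.image ident
  opp := π.namedOpp ident
  opp_involutive := π.namedOpp_involutive hident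
  fst_mem_nodes d hd := by
    obtain ⟨p, rfl⟩ := (π.namedOpp_ne_iff hident).1 hd
    exact Finset.mem_image_of_mem ident (hV.mem_toFinset.2 (π.isLink p).left_mem)
  finite_setOf_opp_ne :=
    have := π.finite_port hV
    (Set.finite_range _).subset fun _ => (π.namedOpp_ne_iff hident).1

variable (hV : V(G).Finite)

theorem mem_nodes_toNetwork {i : ℕ} :
    i ∈ (π.toNetwork hident hV).nodes ↔ ∃ u ∈ V(G), ident u = i := by
  simp only [toNetwork, Finset.mem_image, hV.mem_toFinset]

theorem card_nodes_toNetwork : (π.toNetwork hident hV).nodes.card = V(G).ncard := by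
  classical
  rw [toNetwork, Finset.card_image_of_injOn (by rwa [hV.coe_toFinset]),
    Set.ncard_eq_toFinset_card _ hV]

include hident in
theorem namedOpp_ne_iff_lt (hv : v ∈ V(G)) {i : ℕ} :
    π.namedOpp ident (ident v, i) ≠ (ident v, i) ↔ i < degree G v := by
  rw [π.namedOpp_ne_iff hident]
  constructor
  · rintro ⟨⟨w, j⟩, hw⟩
    obtain ⟨hident_eq, rfl⟩ := Prod.mk.inj hw
    obtain rfl := hident (π.isLink ⟨w, j⟩).left_mem hv hident_eq
    exact j.isLt
  · exact fun hi => ⟨⟨v, i, hi⟩, rfl⟩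

include hident in
theorem ncard_setOf_namedOpp_ne (hv : v ∈ V(G)) :
    {i | π.namedOpp ident (ident v, i) ≠ (ident v, i)}.ncard = degree G v := by
  simp only [π.namedOpp_ne_iff_lt hident hv]
  exact Set.ncard_Iio_nat _

theorem stateAt_collectAlgorithm {Out : Type} (T : ℕ → ℕ) (f : Network → ℕ → Out) (t : ℕ)
    (hv : v ∈ V(G)) :
    (collectAlgorithm T f).stateAt π ident t v =
      ⟨V(G).ncard, ident v, {N | (π.toNetwork hident hV).Agree N t (ident v)}⟩ := by
  induction t generalizing v with
  | zero => exact congrArg (View.mk _ _) (Set.eq_univ_of_forall fun _ => trivial).symm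
  | succ t ih =>
    let s : View := ⟨V(G).ncard, ident v, {N | (π.toNetwork hident hV).Agree N t (ident v)}⟩
    let m (i : Fin (degree G v)) : (ℕ × ℕ) × Set Network := (π.portName ident (π.opp ⟨v, i⟩),
      {N | (π.toNetwork hident hV).Agree N t (ident (π.opp ⟨v, i⟩).1)})
    have hm (i : Fin (degree G v)) : (collectAlgorithm T f).send
        ((collectAlgorithm T f).stateAt π ident t (π.opp ⟨v, i⟩).1) (π.opp ⟨v, i⟩).2 = m i := by
      rw [ih (π.isLink ⟨v, i⟩).right_mem]
      rfl
    rw [LocalAlgorithm.stateAt, ih hv]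
    simp only [hm]
    refine congrArg (View.mk _ _) (Set.ext fun N => forall_congr' fun i => ?_)
    change (_ = (s.message m i).1 ∧ N ∈ (s.message m i).2) ↔ π.namedOpp ident (ident v, i) = _ ∧
      (π.toNetwork hident hV).Agree N t (π.namedOpp ident (ident v, i)).1
    rw [View.message]
    by_cases hi : i < degree G v
    · rw [dif_pos hi, show (ident v, i) = π.portName ident ⟨v, i, hi⟩ from rfl,
        π.namedOpp_portName hident]
      exact and_congr_left fun _ => eq_comm
    · rw [dif_neg hi, not_not.1 ((π.namedOpp_ne_iff_lt hident hv).not.2 hi)]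
      exact and_congr_left fun _ => eq_comm

theorem outputAt_collectAlgorithm {Out : Type} {T : ℕ → ℕ} {f : Network → ℕ → Out}
    (hf : IsLocal T f) (hv : v ∈ V(G)) :
    (collectAlgorithm T f).outputAt π ident v = f (π.toNetwork hident hV) (ident v) := by
  have hcard := π.card_nodes_toNetwork hident hV
  rw [LocalAlgorithm.outputAt, π.stateAt_collectAlgorithm hident hV _ _ _ hv]
  obtain ⟨hcard', hagree⟩ := Classical.epsilon_spec
    (p := fun N : Network => N.nodes.card = V(G).ncard ∧
      (π.toNetwork hident hV).Agree N (T V(G).ncard) (ident v))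
    ⟨π.toNetwork hident hV, hcard, Network.Agree.refl _⟩
  exact (hf _ _ _ _ hcard hcard' hagree).symm

end PortNumbering

/-! ### The algorithm -/

namespace Network

variable {N N₁ N₂ : Network} {F F₁ F₂ : ℕ × ℕ → List (ℕ × ℕ)} {v L r : ℕ}

/-- The paths of the path system `F` that visit `v`. Of the two directions of each path the one with
the smaller first dart is chosen. -/
def pathsThrough (N : Network) (F : ℕ × ℕ → List (ℕ × ℕ)) (v : ℕ) : PathSet :=
  {q | ∃ p, F p ≠ [] ∧ Encodable.encode p < Encodable.encode (far N.opp F p) ∧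
    v ∈ q.vertices ∧ q = trace N.opp Prod.fst (fun d => s(d, N.opp d)) F p}

theorem pathsThrough_subset (h₁ : IsPathSystem N₁.opp Prod.fst F₁) (hL₁ : ∀ p, (F₁ p).length ≤ L)
    (hr : L < r) (hF : EqOfAgree N₁ N₂ r F₁ F₂) (hv : Agree N₁ N₂ (L + r) v) :
    N₁.pathsThrough F₁ v ⊆ N₂.pathsThrough F₂ v := by
  rintro _ ⟨p, hp, hlt, hmem, rfl⟩
  have hpv := h₁.edist_src_le_of_mem_vertices_trace hL₁ hmem
  have hagree : Agree N₁ N₂ r p.1 := (hv.of_edist_le (SimpleGraph.edist_comm.trans_le hpv)).1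
  have hfar := eqOfAgree_far h₁ hL₁ hr hF p hagree
  refine ⟨p, hF p hagree ▸ hp, hfar ▸ hlt, hmem, ?_⟩
  refine congrArg (EdgePath.mk p.1) ?_
  rw [← hF p hagree]
  refine List.map_congr_left fun d hd => ?_
  have hopp := ((hagree.mono hr).of_edist_le (h₁.edist_src_le hL₁ hd)).1.opp_eq one_pos
  simp only [hopp]

/-- A radius up to which the balls in a graph with `2 * n` vertices cannot grow by a factor of more
than `3 / 2` in every step. -/
def trapRadius (n : ℕ) : ℕ := 2 * Nat.log 2 n + 4

theorem two_pow_trapRadius_mul_lt (n : ℕ) : 2 ^ trapRadius n * (2 * n) < 3 ^ trapRadius n := by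
  have hn : n < 2 ^ (Nat.log 2 n + 1) := Nat.lt_pow_succ_log_self one_lt_two n
  calc 2 ^ trapRadius n * (2 * n)
      < 2 ^ trapRadius n * (2 * 2 ^ (Nat.log 2 n + 1)) := by gcongr
    _ = 64 * 8 ^ Nat.log 2 n := by
        rw [trapRadius, show 8 = 2 ^ 3 by rfl, ← pow_mul]
        ring
    _ ≤ 81 * 9 ^ Nat.log 2 n := by gcongr <;> norm_num
    _ = 3 ^ trapRadius n := by
        rw [trapRadius, show 9 = 3 ^ 2 by rfl, ← pow_mul]
        ring

/-- The paths through `v` in the decomposition of a network by `k` rounds of joining. -/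
noncomputable def decompose (k : ℕ) (N : Network) : ℕ → PathSet :=
  N.pathsThrough (N.paths (trapRadius N.nodes.card) k)

/-- The distance up to which `decompose k` depends on a network with `n` nodes. -/
def decomposeRadius (k n : ℕ) : ℕ := 2 ^ k * (4 * trapRadius n + 3)

theorem isLocal_decompose (k : ℕ) : IsLocal (decomposeRadius k) (decompose k) := by
  rintro n N₁ N₂ v hN₁ hN₂ hv
  rw [decompose, decompose, hN₁, hN₂]
  set l := trapRadius n
  have hr : 2 ^ k < 2 ^ k * (4 * l + 2) := lt_mul_right (by positivity) (by omega)
  rw [show decomposeRadius k n = 2 ^ k + 2 ^ k * (4 * l + 2) by rw [decomposeRadius]; ring] at hv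
  exact (pathsThrough_subset (N₁.isPathSystem_paths l k) (N₁.length_paths_le l k) hr
      (eqOfAgree_paths N₁ N₂ l k) hv).antisymm
    (pathsThrough_subset (N₂.isPathSystem_paths l k) (N₂.length_paths_le l k) hr
      (eqOfAgree_paths N₂ N₁ l k) hv.symm)

theorem decomposeRadius_le (k : ℕ) {n : ℕ} (hn : 2 ≤ n) :
    (decomposeRadius k n : ℝ) ≤ 54 * (2 ^ k * Real.log n) := by
  have hone : (1 : ℝ) ≤ Nat.log 2 n := Nat.one_le_cast.2 (Nat.log_pos one_lt_two hn)
  have hlog : (Nat.log 2 n : ℝ) * Real.log 2 ≤ Real.log n :=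
    (le_div_iff₀ (Real.log_pos one_lt_two)).1 (Real.natLog_le_logb n 2)
  calc (decomposeRadius k n : ℝ) = 2 ^ k * (8 * Nat.log 2 n + 19) := by
        rw [decomposeRadius, trapRadius]
        push_cast
        ring
    _ ≤ 2 ^ k * (54 * Real.log n) := by
        gcongr
        nlinarith [Real.log_two_gt_d9]
    _ = 54 * (2 ^ k * Real.log n) := by ring

end Network

section Correctness

variable {α β : Type*} {G : Graph α β} {δ δ' : α → ℝ≥0} {v : α} {k : ℕ}

theorem IsPathDecomposition.mono {L : ℕ} {P : Finset (EdgePath α β)}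
    (h : IsPathDecomposition G δ L P) (hδ : ∀ v ∈ V(G), δ v ≤ δ' v) :
    IsPathDecomposition G δ' L P where
  isPath := h.isPath
  partition := h.partition
  ends_le v hv := (h.ends_le v hv).trans (hδ v hv)
  length_le := h.length_le

theorem EdgePath.vertices_map {α' β' : Type*} (f : α → α') (g : β → β') (q : EdgePath α β) :
    (q.map f g).vertices = q.vertices.map f := by
  simp only [vertices, map, List.map_map, List.map_cons]
  rfl

namespace PortNumbering

variable (π : PortNumbering G) {ident : α → ℕ} (hident : Set.InjOn ident V(G)) (hV : V(G).Finite)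
  {F : Port G → List (Port G)} {F' : ℕ × ℕ → List (ℕ × ℕ)}
include hident

theorem map_trace (hF : ∀ p, (F p).map (π.portName ident) = F' (π.portName ident p)) (p : Port G) :
    (trace π.opp Sigma.fst π.edge F p).map ident (π.edgeName ident) =
      trace (π.namedOpp ident) Prod.fst (fun d => s(d, π.namedOpp ident d)) F'
        (π.portName ident p) := by
  refine congrArg (EdgePath.mk (ident p.1)) ?_
  rw [← hF, List.map_map]
  refine (List.map_map).trans (List.map_congr_left fun d _ => ?_)
  simp only [Function.comp_apply, Prod.map_apply, π.edgeName_edge, π.namedOpp_portName hident]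
  rfl

theorem mem_vertices_map_trace_iff (hv : v ∈ V(G)) (p : Port G) :
    ident v ∈ ((trace π.opp Sigma.fst π.edge F p).map ident (π.edgeName ident)).vertices ↔
      v ∈ (trace π.opp Sigma.fst π.edge F p).vertices := by
  have hvertices : ∀ u ∈ (trace π.opp Sigma.fst π.edge F p).vertices, u ∈ V(G) := by
    intro u hu
    rw [vertices_trace, List.mem_cons, List.mem_map] at hu
    obtain rfl | ⟨d, -, rfl⟩ := hu
    · exact (π.isLink p).left_mem
    · exact (π.isLink d).right_mem
  rw [EdgePath.vertices_map, List.mem_map]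
  constructor
  · rintro ⟨u, hu, huv⟩
    rwa [← hident (hvertices u hu) hv huv]
  · exact fun hmem => ⟨v, hmem, rfl⟩

theorem pathsThrough_toNetwork (h' : IsPathSystem (π.namedOpp ident) Prod.fst F')
    (hF : ∀ p, (F p).map (π.portName ident) = F' (π.portName ident p))
    (hfar : ∀ p, π.portName ident (far π.opp F p) =
      far (π.namedOpp ident) F' (π.portName ident p)) (hv : v ∈ V(G)) :
    (π.toNetwork hident hV).pathsThrough F' (ident v) =
      {q | ∃ p, F p ≠ [] ∧ Encodable.encode (π.portName ident p) <
          Encodable.encode (π.portName ident (far π.opp F p)) ∧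
        v ∈ (trace π.opp Sigma.fst π.edge F p).vertices ∧
        q = (trace π.opp Sigma.fst π.edge F p).map ident (π.edgeName ident)} := by
  have hnil (p : Port G) : F p ≠ [] ↔ F' (π.portName ident p) ≠ [] := by
    rw [← hF, ne_eq, ne_eq, List.map_eq_nil_iff]
  ext q
  constructor
  · rintro ⟨d, hd, hlt, hmem, rfl⟩
    obtain ⟨p, rfl⟩ := (π.namedOpp_ne_iff hident).1 (h'.opp_ne (h'.self_mem hd))
    have htrace := π.map_trace hident hF p
    refine ⟨p, (hnil p).2 hd, by rwa [hfar], ?_, htrace.symm⟩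
    rw [← π.mem_vertices_map_trace_iff hident hv, htrace]
    exact hmem
  · rintro ⟨p, hp, hlt, hmem, rfl⟩
    refine ⟨π.portName ident p, (hnil p).1 hp, by rwa [hfar] at hlt, ?_, π.map_trace hident hF p⟩
    exact (π.mem_vertices_map_trace_iff hident hv p).2 hmem

theorem ncard_ends_le_degree_sub (hdeg : ∀ v ∈ V(G), 2 * k + 4 ≤ degree G v)
    (hF : ∀ p, (F p).map (π.portName ident) = (π.toNetwork hident hV).paths
      (Network.trapRadius (π.toNetwork hident hV).nodes.card) k (π.portName ident p))
    (hv : v ∈ V(G)) :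
    (ends Sigma.fst F v).ncard ≤ degree G v - 2 * k := by
  set N := π.toNetwork hident hV
  set F' := N.paths (Network.trapRadius N.nodes.card) k
  have hports {u : α} (hu : u ∈ V(G)) :
      {i | N.opp (ident u, i) ≠ (ident u, i)}.ncard = degree G u :=
    π.ncard_setOf_namedOpp_ne hident hu
  have hmem {i : ℕ} : i ∈ N.nodes ↔ ∃ u ∈ V(G), ident u = i := π.mem_nodes_toNetwork hident hV
  have hends : (ends Prod.fst F' (ident v)).ncard + 2 * k = degree G v := by
    rw [← hports hv]
    refine Network.ncard_ends_paths (Network.two_pow_trapRadius_mul_lt _) ?_ (hmem.2 ⟨v, hv, rfl⟩)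
    intro i hi
    obtain ⟨u, hu, rfl⟩ := hmem.1 hi
    exact (hdeg u hu).trans_eq (hports hu).symm
  have hpos : 0 < (ends Prod.fst F' (ident v)).ncard := by
    have := hdeg v hv
    omega
  have hle : (ends Sigma.fst F v).ncard ≤ (ends Prod.fst F' (ident v)).ncard := by
    refine Set.ncard_le_ncard_of_injOn (π.portName ident) (fun p hp => ⟨?_, congrArg ident hp.2⟩)
      (π.portName_injective hident).injOn (Set.finite_of_ncard_pos hpos)
    rw [← hF, ne_eq, List.map_eq_nil_iff]
    exact hp.1
  omega

include hV in
theorem computesPathDecomposition_collectAlgorithm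
    (hdeg : ∀ v ∈ V(G), 2 * k + 4 ≤ degree G v) :
    ComputesPathDecomposition (collectAlgorithm (Network.decomposeRadius k) (Network.decompose k))
      π ident (fun v => (degree G v - 2 * k : ℕ)) (2 ^ k) := by
  set N := π.toNetwork hident hV
  set F' := N.paths (Network.trapRadius N.nodes.card) k
  have h' : IsPathSystem (π.namedOpp ident) Prod.fst F' := N.isPathSystem_paths _ k
  obtain ⟨F, hF, hfar, h⟩ := h'.exists_comap (src := Sigma.fst) (π.portName_injective hident)
    (π.namedOpp_portName hident)
    (fun p q => hident (π.isLink p).left_mem (π.isLink q).left_mem)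
    (fun d => (π.namedOpp_ne_iff hident).1)
  have hL (p : Port G) : (F p).length ≤ 2 ^ k := by
    rw [← List.length_map (π.portName ident), hF]
    exact N.length_paths_le _ k _
  have := π.finite_port hV
  obtain ⟨P, hP, hmem⟩ := π.exists_isPathDecomposition_of_isPathSystem h hL
    (Encodable.encode_injective.comp (π.portName_injective hident))
  refine ⟨P, hP.mono fun v hv =>
    Nat.cast_le.2 (π.ncard_ends_le_degree_sub hident hV hdeg hF hv), fun v hv => ?_⟩
  rw [π.outputAt_collectAlgorithm hident hV (Network.isLocal_decompose k) hv, Network.decompose,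
    π.pathsThrough_toNetwork hident hV h' hF hfar hv]
  ext q
  constructor
  · rintro ⟨p, hp, hlt, hpv, rfl⟩
    exact ⟨_, (hmem _).2 ⟨p, hlt, hp, rfl⟩, hpv, rfl⟩
  · rintro ⟨_, hq, hpv, rfl⟩
    obtain ⟨p, hlt, hp, rfl⟩ := (hmem _).1 hq
    exact ⟨p, hp, hlt, hpv, rfl⟩

end PortNumbering

end Correctness

end LocalModel

theorem mainTheorem9_general :
    ∃ C : ℝ, ∀ k : ℕ, ∃ A : LocalModel.LocalAlgorithm LocalModel.PathSet,
      (∀ n : ℕ, 2 ≤ n → (A.rounds n : ℝ) ≤ C * (2 ^ k * Real.log n)) ∧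
      ∀ (α β : Type*) (G : Graph α β), V(G).Finite →
        (∀ v ∈ V(G), 2 * k + 4 ≤ LocalModel.degree G v) →
        ∀ (π : LocalModel.PortNumbering G) (ident : α → ℕ), Set.InjOn ident V(G) →
          LocalModel.ComputesPathDecomposition A π ident
            (fun v => ((LocalModel.degree G v - 2 * k : ℕ) : ℝ≥0)) (2 ^ k) :=
  ⟨54, fun k => ⟨_, fun _ => LocalModel.Network.decomposeRadius_le k,
    fun _ _ _ hV hdeg π _ hident =>
      π.computesPathDecomposition_collectAlgorithm hident hV hdeg⟩⟩

theorem mainTheorem9 :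
    ∃ C : ℝ, ∀ Δ k : ℕ, 0 < k → (k : ℝ) ≤ (Δ : ℝ) / 2 - 2 →
      ∃ A : LocalModel.LocalAlgorithm LocalModel.PathSet,
        (∀ n : ℕ, 2 ≤ n → (A.rounds n : ℝ) ≤ C * (2 ^ k * Real.log n)) ∧
        ∀ (α β : Type*) (G : Graph α β), V(G).Finite → E(G).Finite → 2 ≤ V(G).ncard →
          (∀ v ∈ V(G), LocalModel.degree G v = Δ) →
          ∀ (π : LocalModel.PortNumbering G) (ident : α → ℕ), Set.InjOn ident V(G) →
            LocalModel.ComputesPathDecomposition A π ident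
              (fun _ => ((Δ - 2 * k : ℕ) : ℝ≥0)) (2 ^ k) := by
  obtain ⟨C, hC⟩ := mainTheorem9_general
  refine ⟨C, fun Δ k _ hk => ?_⟩
  have hΔ : 2 * k + 4 ≤ Δ := by
    rify
    linarith
  obtain ⟨A, hrounds, hA⟩ := hC k
  refine ⟨A, hrounds, fun α β G hV _ _ hreg π ident hident => ?_⟩
  obtain ⟨P, hP, hout⟩ :=
    hA α β G hV (fun v hv => hΔ.trans_eq (hreg v hv).symm) π ident hident
  exact ⟨P, hP.mono fun v hv => by rw [hreg v hv], hout⟩
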